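/- \textbf{Setting.} Let $A\in\mathbb R^{n\times n}$, $B\in\mathbb R^{n\times m}$, $\Xi\in\mathbb R^{n\times k}$, let $Q,Q_f\in\mathbb R^{n\times n}$ be symmetric positive semidefinite (PSD) and $R\in\mathbb R^{m\times m}$ symmetric positive definite, let $\hat w^{(1)},\dots,\hat w^{(N)}\in\mathbb R^k$ ($N\ge 1$), and put $\nu:=\frac1N\sum_i\delta_{\hat w^{(i)}}$, $\bar w:=\frac1N\sum_i\hat w^{(i)}$. Consider $x_{t+1}=Ax_t+Bu_t+\Xi w_t$. A control policy $\pi=(\pi_t)_{t\ge0}\in\Pi$ is a sequence of measurable maps with $u_t=\pi_t(x_t)$; an opponent policy $\gamma=(\gamma_t)_{t\ge0}\in\Gamma$ is a sequence of Markov kernels with $w_t\sim\mu_t=\gamma_t(x_t)$. Let $W_2$ be the Wasserstein distance of order $2$ for the Euclidean norm and, for $\theta\ge0$, let $\Gamma_{\mathcal D}$ be the set of $\gamma\in\Gamma$ with $W_2(\gamma_t(x),\nu)\le\theta$ for all $t,x$. Let $\lambda>0$ and $\Phi:=BR^{-1}B^\top-\frac1\lambda\Xi\Xi^\top$. Let $P^{(0)}=Q_f$,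 $P^{(s+1)}=Q+A^\top(I+P^{(s)}\Phi)^{-1}P^{(s)}A$ (so $P_t=P^{(T-t)}$ is the Riccati matrix at time $t$ for horizon $T$). Define $$\rho(\lambda):=\limsup_{T\to\infty}\ \inf_{\pi\in\Pi}\sup_{\gamma\in\Gamma}\frac1T\,\mathbb E^{\pi,\gamma}\Big[x_T^\top Q_fx_T+\sum_{t=0}^{T-1}\big(x_t^\top Qx_t+u_t^\top Ru_t-\lambda W_2(\mu_t,\nu)^2\big)\,\Big|\,x_0=x'\Big]\in[-\infty,\infty],$$ where an expectation of the undefined form $\infty-\infty$ counts as $-\infty$ (the opponent gains nothing from it). The bounds below hold whatever initial state $x'\in\mathbb R^n$ is used in $\rho(\lambda)$. \textbf{Theorem.} Assume that (1) $\lambda$ is larger than every eigenvalue of $\Xi^\top P^{(s)}\Xi$ for all $s\ge0$; (2) the same empirical distribution $\nu$ is used at all times; (3) $\Phi\succeq0$ and $(A,\Phi^{1/2})$ is stabilizable; (4) $(A,Q^{1/2})$ is observable. Then the algebraic Riccati equation $P=Q+A^\top(I+P\Phi)^{-1}PA$ has a unique symmetric PSD solution $P_{ss}$, and the matrices $I+P_{ss}\Phi$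 and $I-A^\top(I+P_{ss}\Phi)^{-1}$ are invertible. Put $$r_{ss}:=[I-A^\top(I+P_{ss}\Phi)^{-1}]^{-1}A^\top(I+P_{ss}\Phi)^{-1}P_{ss}\Xi\bar w,\qquad h^\lambda(x):=x^\top P_{ss}x+2r_{ss}^\top x,$$ and let $\pi^{\star,\lambda}_{ss}$ be the stationary policy $x\mapsto K_{ss}x+L_{ss}$ with $$K_{ss}:=-R^{-1}B^\top(I+P_{ss}\Phi)^{-1}P_{ss}A,\qquad L_{ss}:=-R^{-1}B^\top(I+P_{ss}\Phi)^{-1}(P_{ss}\Xi\bar w+r_{ss}).$$ For every $x\in\mathbb R^n$ and $\gamma\in\Gamma_{\mathcal D}$ the random variables below are integrable for every $T$, and $$\sup_{\gamma\in\Gamma_{\mathcal D}}\ \limsup_{T\to\infty}\frac1T\,\mathbb E^{\pi^{\star,\lambda}_{ss},\gamma}\Big[\sum_{t=0}^{T-1}(x_t^\top Qx_t+u_t^\top Ru_t)+h^\lambda(x_T)\,\Big|\,x_0=x\Big]\le\lambda\theta^2+\rho(\lambda).$$ Moreover, for every $x\in\mathbb R^n$ and every $\bar\Gamma_{\mathcal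 D}\subset\Gamma_{\mathcal D}$ such that $\limsup_{T\to\infty}\frac1T\mathbb E^{\pi^{\star,\lambda}_{ss},\gamma}[h^\lambda(x_T)\mid x_0=x]=0$ for all $\gamma\in\bar\Gamma_{\mathcal D}$, $$\sup_{\gamma\in\bar\Gamma_{\mathcal D}}\ \limsup_{T\to\infty}\frac1T\,\mathbb E^{\pi^{\star,\lambda}_{ss},\gamma}\Big[\sum_{t=0}^{T-1}(x_t^\top Qx_t+u_t^\top Ru_t)\,\Big|\,x_0=x\Big]\le\lambda\theta^2+\rho(\lambda).$$ -/

import Mathlib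

open MeasureTheory ProbabilityTheory Filter
open scoped ENNReal Matrix MatrixOrder

noncomputable section

namespace MinimaxLQ

/-! ### Generic notions -/

/-- Expectation of an extended-real random variable, `E[f⁺] - E[f⁻]`. It is the usual expectation
whenever one of the two parts is finite; in the undefined case `∞ - ∞` its value is `-∞`. -/
def eexp {Ω : Type*} [MeasurableSpace Ω] (P : Measure Ω) (f : Ω → EReal) : EReal :=
  ((∫⁻ ω, (f ω).toENNReal ∂P : ℝ≥0∞) : EReal) - ((∫⁻ ω, (-f ω).toENNReal ∂P : ℝ≥0∞) : EReal)

/-- The Wasserstein distance of order `2` on `ℝᵏ` for the Euclidean norm (possibly `∞`):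
infimum of `(∫ ‖x - y‖² dη)^(1/2)` over all couplings `η`. -/
def W2 {k : ℕ} (μ ν : Measure (Fin k → ℝ)) : ℝ≥0∞ :=
  ⨅ η ∈ {η : Measure ((Fin k → ℝ) × (Fin k → ℝ)) | η.fst = μ ∧ η.snd = ν},
    (∫⁻ z, ‖WithLp.toLp 2 (z.1 - z.2)‖ₑ ^ 2 ∂η) ^ (1 / 2 : ℝ)

/-- All complex eigenvalues lie in the open unit disc. -/
def IsStableMatrix {n : ℕ} (M : Matrix (Fin n) (Fin n) ℝ) : Prop :=
  ∀ z ∈ spectrum ℂ (M.map (algebraMap ℝ ℂ)), ‖z‖ < 1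

/-- `(A, B)` is stabilizable. -/
def Stabilizable {n m : ℕ} (A : Matrix (Fin n) (Fin n) ℝ) (B : Matrix (Fin n) (Fin m) ℝ) : Prop :=
  ∃ K : Matrix (Fin m) (Fin n) ℝ, IsStableMatrix (A + B * K)

/-- `(A, C)` is observable: the observability matrix, with blocks `C`, `C A`, …, `C Aⁿ⁻¹`, has
trivial kernel (that is, rank `n`). -/
def Observable {n p : ℕ} (A : Matrix (Fin n) (Fin n) ℝ) (C : Matrix (Fin p) (Fin n) ℝ) : Prop :=
  ∀ x : Fin n → ℝ, (∀ j < n, (C * A ^ j) *ᵥ x = 0) → x = 0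

/-! ### The control problem -/

/-- Data of the problem: the system `x_{t+1} = A x_t + B u_t + Ξ w_t`, the cost matrices `Q`, `Qf`
(terminal) and `R`, and the sample `ŵ⁽¹⁾, …, ŵ⁽ᴺ⁾` of the disturbance. -/
structure LQProblem (n m k N : ℕ) where
  A : Matrix (Fin n) (Fin n) ℝ
  B : Matrix (Fin n) (Fin m) ℝ
  Ξ : Matrix (Fin n) (Fin k) ℝ
  Q : Matrix (Fin n) (Fin n) ℝ
  Qf : Matrix (Fin n) (Fin n) ℝ
  R : Matrix (Fin m) (Fin m) ℝ
  sample : Fin N → Fin k → ℝ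

/-- Deterministic Markov control policies: `π t x` is the input applied at time `t` in state `x`. -/
structure ControlPolicy (n m : ℕ) where
  act : ℕ → (Fin n → ℝ) → (Fin m → ℝ)
  measurable_act : ∀ t, Measurable (act t)

/-- Deterministic Markov policies of the opponent: `γ t x` is the probability distribution of the
disturbance at time `t` in state `x`, depending measurably on `x`. -/
structure OpponentPolicy (n k : ℕ) where
  dist : ℕ → Kernel (Fin n → ℝ) (Fin k → ℝ)
  markov_dist : ∀ t, IsMarkovKernel (dist t)

variable {n m k N : ℕ}

instance (γ : OpponentPolicy n k) (t : ℕ) : IsMarkovKernel (γ.dist t) := γ.markov_dist t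

namespace LQProblem

variable (S : LQProblem n m k N)

/-- The empirical distribution `ν`. -/
def ν : Measure (Fin k → ℝ) := (N : ℝ≥0∞)⁻¹ • ∑ i, Measure.dirac (S.sample i)

/-- The mean of `ν`. -/
def wbar : Fin k → ℝ := (N : ℝ)⁻¹ • ∑ i, S.sample i

/-- The transition function of the system. -/
def next (x : Fin n → ℝ) (u : Fin m → ℝ) (w : Fin k → ℝ) : Fin n → ℝ :=
  S.A *ᵥ x + S.B *ᵥ u + S.Ξ *ᵥ w

/-- Law of `x_{t+1}` given `x_t`: the image of `w ∼ γ_t(x_t)` under `A x_t + B π_t(x_t) + Ξ w`. -/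
def stepKernel (π : ControlPolicy n m) (γ : OpponentPolicy n k) (t : ℕ) :
    Kernel (Fin n → ℝ) (Fin n → ℝ) :=
  (Kernel.id ×ₖ γ.dist t).map (fun p => S.next p.1 (π.act t p.1) p.2)

theorem measurable_next (π : ControlPolicy n m) (t : ℕ) :
    Measurable (fun p : (Fin n → ℝ) × (Fin k → ℝ) => S.next p.1 (π.act t p.1) p.2) := by
  have h1 : Measurable fun p : (Fin n → ℝ) × (Fin k → ℝ) => π.act t p.1 :=
    (π.measurable_act t).comp measurable_fst
  have hA : Measurable fun x : Fin n → ℝ => S.A *ᵥ x :=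
    (Continuous.matrix_mulVec continuous_const continuous_id).measurable
  have hB : Measurable fun x : Fin m → ℝ => S.B *ᵥ x :=
    (Continuous.matrix_mulVec continuous_const continuous_id).measurable
  have hΞ : Measurable fun x : Fin k → ℝ => S.Ξ *ᵥ x :=
    (Continuous.matrix_mulVec continuous_const continuous_id).measurable
  exact ((hA.comp measurable_fst).add (hB.comp h1)).add (hΞ.comp measurable_snd)

instance (π : ControlPolicy n m) (γ : OpponentPolicy n k) (t : ℕ) :
    IsMarkovKernel (S.stepKernel π γ t) :=
  Kernel.IsMarkovKernel.map _ (S.measurable_next π t)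

/-- The transition kernel seen as a kernel on the past trajectory `x_0, …, x_t`. -/
def pathKernel (π : ControlPolicy n m) (γ : OpponentPolicy n k) (t : ℕ) :
    Kernel (Finset.Iic t → (Fin n → ℝ)) (Fin n → ℝ) :=
  (S.stepKernel π γ t).comap (fun h => h ⟨t, Finset.mem_Iic.2 le_rfl⟩) (measurable_pi_apply _)

instance (π : ControlPolicy n m) (γ : OpponentPolicy n k) (t : ℕ) :
    IsMarkovKernel (S.pathKernel π γ t) :=
  inferInstanceAs (IsMarkovKernel ((S.stepKernel π γ t).comap _ _))

/-- The law of the state trajectory `(x_t)_{t ≥ 0}` under `(π, γ)` with `x_0 = x`. -/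
def law (π : ControlPolicy n m) (γ : OpponentPolicy n k) (x : Fin n → ℝ) :
    Measure (ℕ → (Fin n → ℝ)) :=
  Kernel.traj (X := fun _ => Fin n → ℝ) (S.pathKernel π γ) 0 (fun _ => x)

/-- The running cost `∑_{t<T} (x_tᵀ Q x_t + u_tᵀ R u_t)` along a trajectory, `u_t = π_t(x_t)`. -/
def runCost (π : ControlPolicy n m) (T : ℕ) (ω : ℕ → (Fin n → ℝ)) : ℝ :=
  ∑ t ∈ Finset.range T, (ω t ⬝ᵥ S.Q *ᵥ ω t + π.act t (ω t) ⬝ᵥ S.R *ᵥ π.act t (ω t))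

/-- The total Wasserstein deviation `∑_{t<T} W₂(μ_t, ν)²` along a trajectory, `μ_t = γ_t(x_t)`. -/
def penalty (γ : OpponentPolicy n k) (T : ℕ) (ω : ℕ → (Fin n → ℝ)) : ℝ≥0∞ :=
  ∑ t ∈ Finset.range T, W2 (γ.dist t (ω t)) S.ν ^ 2

/-- The finite-horizon cost with Wasserstein penalty,
`J^λ_{x,T}(π, γ) = (1/T) E[x_Tᵀ Q_f x_T + ∑_{t<T} (x_tᵀ Q x_t + u_tᵀ R u_t - λ W₂(μ_t, ν)²)]`. -/
def finiteCost (lam : ℝ) (T : ℕ) (π : ControlPolicy n m) (γ : OpponentPolicy n k)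
    (x : Fin n → ℝ) : EReal :=
  (((T : ℝ)⁻¹ : ℝ) : EReal) * eexp (S.law π γ x) (fun ω =>
    ((ω T ⬝ᵥ S.Qf *ᵥ ω T + S.runCost π T ω : ℝ) : EReal)
      - ((ENNReal.ofReal lam * S.penalty γ T ω : ℝ≥0∞) : EReal))

/-- The steady-state average cost `ρ(λ) = limsup_T inf_π sup_γ J^λ_{x,T}(π, γ)`. -/
def steadyCost (lam : ℝ) (x : Fin n → ℝ) : EReal :=
  limsup (fun T : ℕ => ⨅ π : ControlPolicy n m, ⨆ γ : OpponentPolicy n k,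
    S.finiteCost lam T π γ x) atTop

/-- The average cost `J_{x,∞}(π, γ)`. -/
def avgCost (π : ControlPolicy n m) (γ : OpponentPolicy n k) (x : Fin n → ℝ) : EReal :=
  limsup (fun T : ℕ => (((T : ℝ)⁻¹ : ℝ) : EReal) *
    eexp (S.law π γ x) (fun ω => ((S.runCost π T ω : ℝ) : EReal))) atTop

/-- The extended average cost `J̃_{x,∞}(π, γ; h)` with bias `h`. -/
def extAvgCost (h : (Fin n → ℝ) → ℝ) (π : ControlPolicy n m) (γ : OpponentPolicy n k)
    (x : Fin n → ℝ) : EReal :=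
  limsup (fun T : ℕ => (((T : ℝ)⁻¹ : ℝ) : EReal) *
    eexp (S.law π γ x) (fun ω => ((S.runCost π T ω + h (ω T) : ℝ) : EReal))) atTop

/-- `limsup_T (1/T) E[h(x_T)]`. -/
def avgBias (h : (Fin n → ℝ) → ℝ) (π : ControlPolicy n m) (γ : OpponentPolicy n k)
    (x : Fin n → ℝ) : EReal :=
  limsup (fun T : ℕ => (((T : ℝ)⁻¹ : ℝ) : EReal) *
    eexp (S.law π γ x) (fun ω => ((h (ω T) : ℝ) : EReal))) atTop

/-- Opponent policies that select distributions in the Wasserstein ball of radius `θ` around `ν`. -/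
def ballPolicies (θ : ℝ) : Set (OpponentPolicy n k) :=
  {γ | ∀ t x, W2 (γ.dist t x) S.ν ≤ ENNReal.ofReal θ}

/-! ### Riccati equation and the stationary policy -/

/-- `Φ = B R⁻¹ Bᵀ - λ⁻¹ Ξ Ξᵀ`. -/
def Φ (lam : ℝ) : Matrix (Fin n) (Fin n) ℝ :=
  S.B * S.R⁻¹ * S.Bᵀ - lam⁻¹ • (S.Ξ * S.Ξᵀ)

/-- One backward step of the Riccati recursion, `P ↦ Q + Aᵀ (I + P Φ)⁻¹ P A`. -/
def riccatiStep (lam : ℝ) (P : Matrix (Fin n) (Fin n) ℝ) : Matrix (Fin n) (Fin n) ℝ :=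
  S.Q + S.Aᵀ * (1 + P * S.Φ lam)⁻¹ * P * S.A

/-- The Riccati recursion started at `Q_f`, indexed by the time to go: `riccati lam s` is `P_{T-s}`
for every horizon `T ≥ s`. -/
def riccati (lam : ℝ) : ℕ → Matrix (Fin n) (Fin n) ℝ
  | 0 => S.Qf
  | s + 1 => S.riccatiStep lam (riccati lam s)

/-- The penalty parameter exceeds every eigenvalue of `Ξᵀ P_t Ξ`, for all `1 ≤ t ≤ T` and all
horizons `T`. -/
def PenaltyCondition (lam : ℝ) : Prop :=
  ∀ s : ℕ, ∀ e ∈ spectrum ℝ (S.Ξᵀ * S.riccati lam s * S.Ξ), e < lam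

/-- `Φ` is positive semidefinite and `(A, Φ^{1/2})` is stabilizable. -/
def StabilizabilityCondition (lam : ℝ) : Prop :=
  (S.Φ lam).PosSemidef ∧ Stabilizable S.A (CFC.sqrt (S.Φ lam))

/-- `(A, Q^{1/2})` is observable. -/
def ObservabilityCondition : Prop := Observable S.A (CFC.sqrt S.Q)

/-- `P` is a symmetric positive semidefinite solution of the algebraic Riccati equation. -/
def IsAREsolution (lam : ℝ) (P : Matrix (Fin n) (Fin n) ℝ) : Prop :=
  P.PosSemidef ∧ P = S.riccatiStep lam P

/-- `r_ss = [I - Aᵀ (I + P Φ)⁻¹]⁻¹ Aᵀ (I + P Φ)⁻¹ P Ξ w̄`. -/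
def rss (lam : ℝ) (P : Matrix (Fin n) (Fin n) ℝ) : Fin n → ℝ :=
  (1 - S.Aᵀ * (1 + P * S.Φ lam)⁻¹)⁻¹ *ᵥ
    ((S.Aᵀ * (1 + P * S.Φ lam)⁻¹ * P * S.Ξ) *ᵥ S.wbar)

/-- `K_ss = -R⁻¹ Bᵀ (I + P Φ)⁻¹ P A`. -/
def Kss (lam : ℝ) (P : Matrix (Fin n) (Fin n) ℝ) : Matrix (Fin m) (Fin n) ℝ :=
  -(S.R⁻¹ * S.Bᵀ * (1 + P * S.Φ lam)⁻¹ * P * S.A)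

/-- `L_ss = -R⁻¹ Bᵀ (I + P Φ)⁻¹ (P Ξ w̄ + r_ss)`. -/
def Lss (lam : ℝ) (P : Matrix (Fin n) (Fin n) ℝ) : Fin m → ℝ :=
  -((S.R⁻¹ * S.Bᵀ * (1 + P * S.Φ lam)⁻¹) *ᵥ ((P * S.Ξ) *ᵥ S.wbar + S.rss lam P))

/-- The stationary policy `π_ss(x) = K_ss x + L_ss`. -/
def policySS (lam : ℝ) (P : Matrix (Fin n) (Fin n) ℝ) : ControlPolicy n m where
  act _ x := S.Kss lam P *ᵥ x + S.Lss lam P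
  measurable_act _ :=
    ((Continuous.matrix_mulVec continuous_const continuous_id).add continuous_const).measurable

/-- The bias `h(x) = xᵀ P x + 2 r_ssᵀ x`. -/
def bias (lam : ℝ) (P : Matrix (Fin n) (Fin n) ℝ) (x : Fin n → ℝ) : ℝ :=
  x ⬝ᵥ P *ᵥ x + 2 * (S.rss lam P ⬝ᵥ x)

end LQProblem

end MinimaxLQ

end

namespace MinimaxLQ

/-! ### Quadratic forms and the Riccati map -/

section LinearAlgebra

variable {ι : Type*} [Fintype ι]

/-! Everything rests on one exact formula for a single stage, `stage_identity`. Take the cost-to-go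
`yᵀPy + 2rᵀy`, a state x, a disturbance w coupled to a sample point v, and the costate p = (I +
PΦ)⁻¹(P(Ax + Ξw̄) + r). The saddle point has control -R⁻¹Bᵀp and mean disturbance w̄ + λ⁻¹Ξᵀp. In
terms of the deviations e and δ from it, cost-to-go plus stage cost minus λ|w - v|² is a new
quadratic function of x, plus a constant, a term linear in v - w̄ that averages to zero under ν, a
nonnegative quadratic in e, a cross term in e and δ, and `deviationGain`, which does not involve x.
Let c be `stageConst` plus the average over i of the supremum over δ of the gain against the i-th
sample point.

Upper bound: the stationary policy is e = 0, and (P_ss, r_ss) is fixed by the backward step.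
Integrating the formula against nearly optimal couplings and telescoping (`integral_value_next_le`,
`sum_integral_stageCost_le`) bounds the expected cost plus the expected bias by h(x) + T(c + λθ²).
As P_ss is positive definite, h is bounded below, and dropping it costs only a constant.

Lower bound, c ≤ ρ(λ): fix deviations δᵢ with sum zero and let the opponent pair the i-th sample
with the saddle disturbance plus δᵢ. The cross term averages out, so no control gains
(`le_stage_average`, `exists_le_finiteCost`). The terminal cost is discarded, so the backward
recursion starts from 0; it converges together with its linear part (`exists_tendsto_riccatiZero`,
`tendsto_linearZero`), and a Cesàro mean yields the limit. Recentring removes the sum constraint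
because ΞᵀPΞ ≤ λI, and then the suprema can be taken separately (`le_steadyCost`, `sum_ciSup_le`).
They are finite because ρ(λ) is; if ρ(λ) = ∞ there is nothing to prove.

Invertibility, uniqueness and stability all come from xᵀPx being a Lyapunov function of the closed
loop that strictly decreases over n steps, by observability (`eq_zero_of_quad_le`). -/

theorem dotProduct_mulVec_symm {P : Matrix ι ι ℝ} (hP : Pᵀ = P) (x y : ι → ℝ) :
    x ⬝ᵥ P *ᵥ y = P *ᵥ x ⬝ᵥ y := by
  rw [Matrix.dotProduct_mulVec, ← Matrix.mulVec_transpose, hP]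

theorem dotProduct_mulVec_transpose {κ : Type*} [Fintype κ] (B : Matrix ι κ ℝ) (x : ι → ℝ)
    (y : κ → ℝ) : x ⬝ᵥ B *ᵥ y = Bᵀ *ᵥ x ⬝ᵥ y := by
  rw [Matrix.dotProduct_mulVec, ← Matrix.mulVec_transpose]

theorem quad_add {P : Matrix ι ι ℝ} (hP : Pᵀ = P) (a d : ι → ℝ) :
    (a + d) ⬝ᵥ P *ᵥ (a + d) = a ⬝ᵥ P *ᵥ a + 2 * (P *ᵥ a ⬝ᵥ d) + d ⬝ᵥ P *ᵥ d := by
  rw [Matrix.mulVec_add, add_dotProduct, dotProduct_add, dotProduct_add,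
    dotProduct_mulVec_symm hP a d, dotProduct_comm d (P *ᵥ a)]
  ring

omit [Fintype ι] in
theorem posSemidef_transpose {P : Matrix ι ι ℝ} (hP : P.PosSemidef) : Pᵀ = P := by
  simpa [Matrix.IsHermitian, Matrix.conjTranspose_eq_transpose_of_trivial] using hP.isHermitian

theorem posSemidef_quad_nonneg {P : Matrix ι ι ℝ} (hP : P.PosSemidef) (x : ι → ℝ) :
    0 ≤ x ⬝ᵥ P *ᵥ x := by
  simpa using hP.dotProduct_mulVec_nonneg x

theorem posSemidef_of_quad {P : Matrix ι ι ℝ} (hP : Pᵀ = P) (h : ∀ x, 0 ≤ x ⬝ᵥ P *ᵥ x) :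
    P.PosSemidef :=
  .of_dotProduct_mulVec_nonneg (by
    simpa [Matrix.IsHermitian, Matrix.conjTranspose_eq_transpose_of_trivial] using hP)
    (by simpa using h)

theorem mulVec_eq_zero_of_quad {P : Matrix ι ι ℝ} (hP : P.PosSemidef) {x : ι → ℝ}
    (h : x ⬝ᵥ P *ᵥ x = 0) : P *ᵥ x = 0 :=
  (hP.dotProduct_mulVec_zero_iff x).1 (by simpa using h)

theorem eq_of_quad {P P' : Matrix ι ι ℝ} (hP : Pᵀ = P) (hP' : P'ᵀ = P')
    (h : ∀ x, x ⬝ᵥ P *ᵥ x = x ⬝ᵥ P' *ᵥ x) : P = P' := by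
  classical
  have key : ∀ a d, P *ᵥ a ⬝ᵥ d = P' *ᵥ a ⬝ᵥ d := fun a d => by
    have := quad_add hP a d
    have := quad_add hP' a d
    have := h a
    have := h d
    have := h (a + d)
    linarith
  refine Matrix.ext_of_mulVec_single fun i => ?_
  exact dotProduct_eq _ _ fun d => key _ d

variable [DecidableEq ι]

theorem isUnit_of_mulVec {M : Matrix ι ι ℝ} (h : ∀ x, M *ᵥ x = 0 → x = 0) : IsUnit M := by
  rw [← Matrix.mulVec_injective_iff_isUnit]
  intro x y hxy
  have := h (x - y) (by rw [Matrix.mulVec_sub]; exact sub_eq_zero.2 hxy)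
  exact sub_eq_zero.1 this

variable {P Φ : Matrix ι ι ℝ}

/-- If x = -PΦx, pairing with Φx gives xᵀΦx = -(Φx)ᵀP(Φx). Both signs force Φx = 0, hence x = 0. -/
theorem isUnit_one_add_mul (hP : P.PosSemidef) (hΦ : Φ.PosSemidef) : IsUnit (1 + P * Φ) := by
  refine isUnit_of_mulVec fun x hx => ?_
  rw [Matrix.add_mulVec, Matrix.one_mulVec, ← Matrix.mulVec_mulVec] at hx
  have h1 : x ⬝ᵥ Φ *ᵥ x = - (Φ *ᵥ x ⬝ᵥ P *ᵥ (Φ *ᵥ x)) := by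
    rw [dotProduct_comm, eq_neg_iff_add_eq_zero, ← dotProduct_add, hx, dotProduct_zero]
  have h2 : Φ *ᵥ x = 0 := mulVec_eq_zero_of_quad hΦ (le_antisymm
    (by rw [h1]; have := posSemidef_quad_nonneg hP (Φ *ᵥ x); linarith)
    (posSemidef_quad_nonneg hΦ x))
  simpa [h2] using hx

theorem inv_one_add_mul_mulVec (h : IsUnit (1 + P * Φ)) (y : ι → ℝ) :
    (1 + P * Φ)⁻¹ *ᵥ y + P *ᵥ (Φ *ᵥ ((1 + P * Φ)⁻¹ *ᵥ y)) = y := by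
  have : (1 + P * Φ) *ᵥ ((1 + P * Φ)⁻¹ *ᵥ y) = y := by
    rw [Matrix.mulVec_mulVec, Matrix.mul_nonsing_inv _ ((Matrix.isUnit_iff_isUnit_det _).1 h),
      Matrix.one_mulVec]
  rwa [Matrix.add_mulVec, Matrix.one_mulVec, ← Matrix.mulVec_mulVec] at this

theorem transpose_inv_one_add_mul (hP : Pᵀ = P) (hΦ : Φᵀ = Φ) :
    ((1 + P * Φ)⁻¹)ᵀ = (1 + Φ * P)⁻¹ := by
  rw [Matrix.transpose_nonsing_inv, Matrix.transpose_add, Matrix.transpose_mul, hP, hΦ,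
    Matrix.transpose_one]

theorem inv_one_add_mul_mul (hP : P.PosSemidef) (hΦ : Φ.PosSemidef) :
    (1 + P * Φ)⁻¹ * P = P * (1 + Φ * P)⁻¹ := by
  have h1 := (Matrix.isUnit_iff_isUnit_det _).1 (isUnit_one_add_mul hP hΦ)
  have h2 := (Matrix.isUnit_iff_isUnit_det _).1 (isUnit_one_add_mul hΦ hP)
  calc (1 + P * Φ)⁻¹ * P = (1 + P * Φ)⁻¹ * (P * (1 + Φ * P) * (1 + Φ * P)⁻¹) := by
        rw [Matrix.mul_assoc P, Matrix.mul_nonsing_inv _ h2, Matrix.mul_one]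
    _ = (1 + P * Φ)⁻¹ * ((1 + P * Φ) * P * (1 + Φ * P)⁻¹) := by noncomm_ring
    _ = P * (1 + Φ * P)⁻¹ := by
        rw [← Matrix.mul_assoc, ← Matrix.mul_assoc, Matrix.nonsing_inv_mul _ h1, Matrix.one_mul]

theorem transpose_inv_one_add_mul_mul (hP : P.PosSemidef) (hΦ : Φ.PosSemidef) :
    ((1 + P * Φ)⁻¹ * P)ᵀ = (1 + P * Φ)⁻¹ * P := by
  rw [Matrix.transpose_mul, transpose_inv_one_add_mul (posSemidef_transpose hP)
    (posSemidef_transpose hΦ), posSemidef_transpose hP, inv_one_add_mul_mul hP hΦ]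

theorem inv_one_add_mul_eq_sub (hP : P.PosSemidef) (hΦ : Φ.PosSemidef) :
    (1 + Φ * P)⁻¹ = 1 - Φ * ((1 + P * Φ)⁻¹ * P) := by
  have h2 := (Matrix.isUnit_iff_isUnit_det _).1 (isUnit_one_add_mul hΦ hP)
  rw [inv_one_add_mul_mul hP hΦ, eq_sub_iff_add_eq, ← Matrix.mul_assoc]
  calc (1 + Φ * P)⁻¹ + Φ * P * (1 + Φ * P)⁻¹ = (1 + Φ * P) * (1 + Φ * P)⁻¹ := by noncomm_ring
    _ = 1 := Matrix.mul_nonsing_inv _ h2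

/-- The costate `q` and the next state `z = y - Φ q` reached from `y` under optimal control. -/
theorem costate_eq (hP : P.PosSemidef) (hΦ : Φ.PosSemidef) (y : ι → ℝ) :
    P *ᵥ (y - Φ *ᵥ (((1 + P * Φ)⁻¹ * P) *ᵥ y)) = ((1 + P * Φ)⁻¹ * P) *ᵥ y := by
  have := inv_one_add_mul_mulVec (isUnit_one_add_mul hP hΦ) (P *ᵥ y)
  rw [← Matrix.mulVec_mulVec, Matrix.mulVec_sub, sub_eq_iff_eq_add]
  exact this.symm

/-- With q the costate and z = y - Φq one has Pz = q (`costate_eq`). The right side is the cost of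
steering y to z; `quad_gain_le` shows that no other steering is cheaper. -/
theorem quad_gain_eq (hP : P.PosSemidef) (hΦ : Φ.PosSemidef) (y : ι → ℝ) :
    y ⬝ᵥ ((1 + P * Φ)⁻¹ * P) *ᵥ y =
      (y - Φ *ᵥ (((1 + P * Φ)⁻¹ * P) *ᵥ y)) ⬝ᵥ P *ᵥ (y - Φ *ᵥ (((1 + P * Φ)⁻¹ * P) *ᵥ y))
        + (((1 + P * Φ)⁻¹ * P) *ᵥ y) ⬝ᵥ Φ *ᵥ (((1 + P * Φ)⁻¹ * P) *ᵥ y) := by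
  rw [costate_eq hP hΦ, sub_dotProduct, dotProduct_comm (Φ *ᵥ _)]
  ring

theorem quad_gain_nonneg (hP : P.PosSemidef) (hΦ : Φ.PosSemidef) (y : ι → ℝ) :
    0 ≤ y ⬝ᵥ ((1 + P * Φ)⁻¹ * P) *ᵥ y := by
  rw [quad_gain_eq hP hΦ]
  exact add_nonneg (posSemidef_quad_nonneg hP _) (posSemidef_quad_nonneg hΦ _)

/-- Completion of the square at v = -Sq: the terms linear in the remainder e cancel because P(y -
Φq) = q, and what is left over is nonnegative. The form with a root S of Φ matches feedbacks for the
pair (A, Φ^{1/2}). -/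
theorem quad_gain_le (hP : P.PosSemidef) (hΦ : Φ.PosSemidef) {S : Matrix ι ι ℝ} (hS : Sᵀ = S)
    (hSΦ : S * S = Φ) (y v : ι → ℝ) :
    y ⬝ᵥ ((1 + P * Φ)⁻¹ * P) *ᵥ y ≤ (y + S *ᵥ v) ⬝ᵥ P *ᵥ (y + S *ᵥ v) + v ⬝ᵥ v := by
  rw [quad_gain_eq hP hΦ]
  have hc := costate_eq hP hΦ y
  set q := ((1 + P * Φ)⁻¹ * P) *ᵥ y
  obtain ⟨e, rfl⟩ : ∃ e, v = e - S *ᵥ q := ⟨v + S *ᵥ q, by simp⟩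
  have h1 : y + S *ᵥ (e - S *ᵥ q) = (y - Φ *ᵥ q) + S *ᵥ e := by
    rw [Matrix.mulVec_sub, Matrix.mulVec_mulVec, hSΦ]; abel
  have h2 : q ⬝ᵥ Φ *ᵥ q = S *ᵥ q ⬝ᵥ S *ᵥ q := by
    rw [← hSΦ, ← Matrix.mulVec_mulVec, dotProduct_mulVec_symm hS]
  have h3 : (e - S *ᵥ q) ⬝ᵥ (e - S *ᵥ q)
      = e ⬝ᵥ e - 2 * (q ⬝ᵥ S *ᵥ e) + S *ᵥ q ⬝ᵥ S *ᵥ q := by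
    rw [dotProduct_mulVec_symm hS q e, sub_dotProduct, dotProduct_sub, dotProduct_sub,
      dotProduct_comm e (S *ᵥ q)]
    ring
  rw [h1, quad_add (posSemidef_transpose hP), hc, h2, h3]
  have := posSemidef_quad_nonneg hP (S *ᵥ e)
  have : 0 ≤ e ⬝ᵥ e := by simpa using dotProduct_self_star_nonneg e
  linarith

theorem quad_gain_le_costate (hP : P.PosSemidef) (hΦ : Φ.PosSemidef) (y q : ι → ℝ) :
    y ⬝ᵥ ((1 + P * Φ)⁻¹ * P) *ᵥ y ≤ (y - Φ *ᵥ q) ⬝ᵥ P *ᵥ (y - Φ *ᵥ q) + q ⬝ᵥ Φ *ᵥ q := by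
  have hS : (CFC.sqrt Φ)ᵀ = CFC.sqrt Φ :=
    posSemidef_transpose (Matrix.nonneg_iff_posSemidef.1 (CFC.sqrt_nonneg Φ))
  have hSΦ : CFC.sqrt Φ * CFC.sqrt Φ = Φ :=
    CFC.sqrt_mul_sqrt_self Φ (Matrix.nonneg_iff_posSemidef.2 hΦ)
  have h1 := quad_gain_le hP hΦ hS hSΦ y (-(CFC.sqrt Φ *ᵥ q))
  have h2 : y + CFC.sqrt Φ *ᵥ (-(CFC.sqrt Φ *ᵥ q)) = y - Φ *ᵥ q := by
    rw [Matrix.mulVec_neg, Matrix.mulVec_mulVec, hSΦ]; abel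
  have h3 : -(CFC.sqrt Φ *ᵥ q) ⬝ᵥ -(CFC.sqrt Φ *ᵥ q) = q ⬝ᵥ Φ *ᵥ q := by
    rw [neg_dotProduct_neg, ← dotProduct_mulVec_symm hS, Matrix.mulVec_mulVec, hSΦ]
  rwa [h2, h3] at h1

/-- A minimum of increasing functions is increasing: the costate that is optimal for `P'` is a
competitor for `P`. -/
theorem quad_gain_mono {P' : Matrix ι ι ℝ} (hP : P.PosSemidef) (hP' : P'.PosSemidef)
    (hΦ : Φ.PosSemidef) (h : ∀ x, x ⬝ᵥ P *ᵥ x ≤ x ⬝ᵥ P' *ᵥ x) (y : ι → ℝ) :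
    y ⬝ᵥ ((1 + P * Φ)⁻¹ * P) *ᵥ y ≤ y ⬝ᵥ ((1 + P' * Φ)⁻¹ * P') *ᵥ y := by
  rw [quad_gain_eq hP' hΦ y]
  exact (quad_gain_le_costate hP hΦ y _).trans (by gcongr; exact h _)

end LinearAlgebra

/-! ### Norm estimates and limits of matrices -/

section Limits

open Topology

variable {ι : Type*} [Fintype ι]

theorem dotProduct_le_norm (x y : ι → ℝ) : |x ⬝ᵥ y| ≤ Fintype.card ι * (‖x‖ * ‖y‖) := by
  calc |x ⬝ᵥ y| ≤ ∑ i, |x i * y i| := Finset.abs_sum_le_sum_abs _ _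
    _ ≤ ∑ _i : ι, ‖x‖ * ‖y‖ := by
        refine Finset.sum_le_sum fun i _ => ?_
        rw [abs_mul]
        exact mul_le_mul (norm_le_pi_norm x i) (norm_le_pi_norm y i) (abs_nonneg _) (norm_nonneg _)
    _ = _ := by simp

theorem exists_norm_mulVec_le {κ : Type*} [Fintype κ] (W : Matrix ι κ ℝ) :
    ∃ C, 0 ≤ C ∧ ∀ x, ‖W *ᵥ x‖ ≤ C * ‖x‖ := by
  let T := LinearMap.toContinuousLinearMap (Matrix.mulVecLin W)
  exact ⟨‖T‖, norm_nonneg _, fun x => T.le_opNorm x⟩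

theorem exists_quad_le (W : Matrix ι ι ℝ) :
    ∃ C, 0 ≤ C ∧ ∀ x, |x ⬝ᵥ W *ᵥ x| ≤ C * ‖x‖ ^ 2 := by
  obtain ⟨C, hC, h⟩ := exists_norm_mulVec_le W
  refine ⟨Fintype.card ι * C, by positivity, fun x => (dotProduct_le_norm _ _).trans ?_⟩
  calc (Fintype.card ι : ℝ) * (‖x‖ * ‖W *ᵥ x‖) ≤ Fintype.card ι * (‖x‖ * (C * ‖x‖)) := by
        gcongr; exact h x
    _ = _ := by ring

theorem exists_pos_le_quad (W : Matrix ι ι ℝ) (h : ∀ x ≠ 0, 0 < x ⬝ᵥ W *ᵥ x) :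
    ∃ c, 0 < c ∧ ∀ x, c * ‖x‖ ^ 2 ≤ x ⬝ᵥ W *ᵥ x := by
  cases isEmpty_or_nonempty ι with
  | inl _ => exact ⟨1, one_pos, fun x => by simp [Subsingleton.elim x 0]⟩
  | inr _ =>
    have hcont : Continuous fun x : ι → ℝ => x ⬝ᵥ W *ᵥ x :=
      continuous_id.dotProduct (Continuous.matrix_mulVec continuous_const continuous_id)
    obtain ⟨z, hz, hmin⟩ := (isCompact_sphere (0 : ι → ℝ) 1).exists_isMinOn
      ((NormedSpace.sphere_nonempty (x := (0 : ι → ℝ))).2 zero_le_one) hcont.continuousOn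
    have hz0 : z ≠ 0 := by
      rintro rfl
      simp at hz
    refine ⟨_, h z hz0, fun x => ?_⟩
    by_cases hx : x = 0
    · simp [hx]
    have hn : 0 < ‖x‖ := norm_pos_iff.2 hx
    have h1 := hmin (a := ‖x‖⁻¹ • x) (by simp [norm_smul, hn.ne'])
    simp only [Set.mem_ofPred_eq, Matrix.mulVec_smul, smul_dotProduct, dotProduct_smul,
      smul_eq_mul] at h1
    calc z ⬝ᵥ W *ᵥ z * ‖x‖ ^ 2 ≤ (‖x‖⁻¹ * (‖x‖⁻¹ * x ⬝ᵥ W *ᵥ x)) * ‖x‖ ^ 2 := by gcongr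
      _ = _ := by field_simp

section Spectral

attribute [local instance] Matrix.linftyOpNormedRing Matrix.linftyOpNormedAlgebra

/-- Gelfand's formula: any r strictly between the spectral radius and 1 eventually dominates the
j-th root of the norm of the j-th power. -/
theorem exists_geometric_bound_complex [DecidableEq ι] (a : Matrix ι ι ℂ)
    (ha : ∀ z ∈ spectrum ℂ a, ‖z‖ < 1) :
    ∃ C r : ℝ, 0 ≤ C ∧ 0 ≤ r ∧ r < 1 ∧ ∀ j (x : ι → ℂ), ‖a ^ j *ᵥ x‖ ≤ C * r ^ j * ‖x‖ := by
  cases isEmpty_or_nonempty ι with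
  | inl _ => exact ⟨0, 0, le_rfl, le_rfl, one_pos, fun j x => by simp [Subsingleton.elim _ (0 : ι → ℂ)]⟩
  | inr _ =>
  have : CompleteSpace (Matrix ι ι ℂ) := FiniteDimensional.complete ℂ _
  have h1 : spectralRadius ℂ a < (1 : NNReal) := by
    refine spectrum.spectralRadius_lt_of_forall_lt a fun z hz => ?_
    simpa [← NNReal.coe_lt_coe] using ha z hz
  obtain ⟨r, hr, hr1⟩ := ENNReal.lt_iff_exists_nnreal_btwn.1 h1
  have hev : ∀ᶠ j : ℕ in atTop, ‖a ^ j‖ ≤ (r : ℝ) ^ j := by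
    filter_upwards [(spectrum.pow_nnnorm_pow_one_div_tendsto_nhds_spectralRadius a).eventually_lt_const
      hr, eventually_gt_atTop 0] with j hj hj0
    have h2 : (‖a ^ j‖₊ : ℝ≥0∞) ≤ (r : ℝ≥0∞) ^ j := by
      have h3 := ENNReal.rpow_le_rpow hj.le (Nat.cast_nonneg (α := ℝ) j)
      rwa [← ENNReal.rpow_mul, one_div_mul_cancel (by positivity), ENNReal.rpow_one,
        ENNReal.rpow_natCast] at h3
    exact_mod_cast h2
  obtain ⟨J, hJ⟩ := eventually_atTop.1 hev
  have hr1' : (r : ℝ) < 1 := by exact_mod_cast hr1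
  have hr0 : 0 < (r : ℝ) := by exact_mod_cast (zero_le.trans_lt hr)
  -- The sum absorbs the finitely many powers below `J`, about which Gelfand's formula says nothing.
  let C : ℝ := 1 + ∑ j ∈ Finset.range J, ‖a ^ j‖ / (r : ℝ) ^ j
  have hC : 1 ≤ C := le_add_of_nonneg_right (Finset.sum_nonneg fun _ _ => by positivity)
  refine ⟨C, r, zero_le_one.trans hC, r.2, hr1', fun j x => ?_⟩
  refine (Matrix.linfty_opNorm_mulVec _ _).trans (mul_le_mul_of_nonneg_right ?_ (norm_nonneg _))
  by_cases hj : J ≤ j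
  · calc ‖a ^ j‖ ≤ 1 * (r : ℝ) ^ j := by rw [one_mul]; exact hJ j hj
      _ ≤ _ := by gcongr
  · rw [← div_le_iff₀ (by positivity)]
    refine (Finset.single_le_sum (f := fun j => ‖a ^ j‖ / (r : ℝ) ^ j)
      (fun _ _ => by positivity) (Finset.mem_range.2 (not_le.1 hj))).trans ?_
    exact le_add_of_nonneg_left zero_le_one

end Spectral

theorem IsStableMatrix.exists_geometric_bound {n : ℕ} {M : Matrix (Fin n) (Fin n) ℝ}
    (hM : IsStableMatrix M) :
    ∃ C r : ℝ, 0 ≤ C ∧ 0 ≤ r ∧ r < 1 ∧ ∀ j (x : Fin n → ℝ), ‖M ^ j *ᵥ x‖ ≤ C * r ^ j * ‖x‖ := by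
  obtain ⟨C, r, hC, h0, h1, h⟩ := exists_geometric_bound_complex _ hM
  have hnorm : ∀ x : Fin n → ℝ, ‖fun i => (algebraMap ℝ ℂ) (x i)‖ = ‖x‖ := fun x => by
    simp [Pi.norm_def]
  refine ⟨C, r, hC, h0, h1, fun j x => ?_⟩
  have h2 := h j (fun i => algebraMap ℝ ℂ (x i))
  rw [hnorm] at h2
  rw [← hnorm]
  convert h2 using 2
  ext i
  have : (M.map (algebraMap ℝ ℂ)) ^ j = (M ^ j).map (algebraMap ℝ ℂ) :=
    (map_pow (algebraMap ℝ ℂ).mapMatrix M j).symm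
  rw [this]
  exact RingHom.map_mulVec (algebraMap ℝ ℂ) (M ^ j) x i

/-- Each quadratic form value converges by monotonicity; polarization on basis vectors turns this
into convergence of the entries. -/
theorem exists_tendsto_of_monotone_quad [DecidableEq ι] (p : ℕ → Matrix ι ι ℝ)
    (hsymm : ∀ s, (p s)ᵀ = p s) (hmono : ∀ x, Monotone fun s => x ⬝ᵥ p s *ᵥ x)
    (hbdd : ∀ x, ∃ C, ∀ s, x ⬝ᵥ p s *ᵥ x ≤ C) :
    ∃ P, Tendsto p atTop (𝓝 P) := by
  have hq : ∀ x, ∃ l, Tendsto (fun s => x ⬝ᵥ p s *ᵥ x) atTop (𝓝 l) := fun x => by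
    obtain ⟨C, hC⟩ := hbdd x
    exact ⟨_, tendsto_atTop_ciSup (hmono x) ⟨C, by rintro _ ⟨s, rfl⟩; exact hC s⟩⟩
  have he : ∀ i j, ∃ l, Tendsto (fun s => p s i j) atTop (𝓝 l) := fun i j => by
    obtain ⟨l1, h1⟩ := hq (Pi.single i 1 + Pi.single j 1)
    obtain ⟨l2, h2⟩ := hq (Pi.single i 1)
    obtain ⟨l3, h3⟩ := hq (Pi.single j 1)
    refine ⟨(l1 - l2 - l3) / 2, (((h1.sub h2).sub h3).div_const 2).congr fun s => ?_⟩
    have h4 : p s *ᵥ Pi.single i 1 ⬝ᵥ Pi.single j 1 = p s i j := by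
      rw [← congrFun (congrFun (hsymm s) i) j]
      simp
    rw [quad_add (hsymm s), h4]
    ring
  choose P hP using he
  exact ⟨Matrix.of P, tendsto_pi_nhds.2 fun i => tendsto_pi_nhds.2 fun j => hP i j⟩

theorem tendsto_inv_one_add_mul [DecidableEq ι] {p : ℕ → Matrix ι ι ℝ} {P Φ : Matrix ι ι ℝ}
    (hp : Tendsto p atTop (𝓝 P)) (h : IsUnit (1 + P * Φ)) :
    Tendsto (fun s => (1 + p s * Φ)⁻¹) atTop (𝓝 (1 + P * Φ)⁻¹) := by
  have h1 : Tendsto (fun s => 1 + p s * Φ) atTop (𝓝 (1 + P * Φ)) :=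
    tendsto_const_nhds.add (hp.mul tendsto_const_nhds)
  have hdet : Tendsto (fun s => (1 + p s * Φ).det) atTop (𝓝 (1 + P * Φ).det) :=
    ((continuous_id.matrix_det).tendsto _).comp h1
  have hadj : Tendsto (fun s => (1 + p s * Φ).adjugate) atTop (𝓝 (1 + P * Φ).adjugate) :=
    ((continuous_id.matrix_adjugate).tendsto _).comp h1
  simp only [Matrix.inv_def, Ring.inverse_eq_inv']
  exact (hdet.inv₀ ((Matrix.isUnit_iff_isUnit_det _).1 h).ne_zero).smul hadj

theorem tendsto_mulVec {κ : Type*} {α : Type*} {l : Filter α} {f : α → Matrix κ ι ℝ}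
    {g : α → ι → ℝ} {A : Matrix κ ι ℝ} {x : ι → ℝ} (hf : Tendsto f l (𝓝 A))
    (hg : Tendsto g l (𝓝 x)) : Tendsto (fun a => f a *ᵥ g a) l (𝓝 (A *ᵥ x)) :=
  ((Continuous.matrix_mulVec continuous_fst continuous_snd).tendsto (A, x)).comp
    (hf.prodMk_nhds hg)

theorem tendsto_dotProduct {α : Type*} {l : Filter α} {f g : α → ι → ℝ} {x y : ι → ℝ}
    (hf : Tendsto f l (𝓝 x)) (hg : Tendsto g l (𝓝 y)) :
    Tendsto (fun a => f a ⬝ᵥ g a) l (𝓝 (x ⬝ᵥ y)) :=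
  ((Continuous.dotProduct continuous_fst continuous_snd).tendsto (x, y)).comp
    (hf.prodMk_nhds hg)

/-- A sequence that contracts by `c < 1` over blocks of length `m` tends to `0`. -/
theorem tendsto_zero_of_block_contraction {a : ℕ → ℝ} (ha : ∀ s, 0 ≤ a s) {c : ℝ} (hc0 : 0 ≤ c)
    (hc1 : c < 1) {m s₀ : ℕ} (hm : 0 < m) (h : ∀ s, s₀ ≤ s → a (s + m) ≤ c * a s) :
    Tendsto a atTop (𝓝 0) := by
  -- A common bound for the first block, which starts the induction by steps of length `m`.
  let D := ∑ i ∈ Finset.range m, a (s₀ + i)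
  have hb : ∀ k, a (s₀ + k) ≤ c ^ (k / m) * D := by
    intro k
    induction k using Nat.strong_induction_on with
    | _ k ih =>
      by_cases hk : k < m
      · rw [Nat.div_eq_of_lt hk, pow_zero, one_mul]
        exact Finset.single_le_sum (f := fun i => a (s₀ + i)) (fun i _ => ha _)
          (Finset.mem_range.2 hk)
      · obtain ⟨j, rfl⟩ := Nat.exists_eq_add_of_le (not_lt.1 hk)
        have h1 := ih j (by omega)
        have h2 := h (s₀ + j) (by omega)
        rw [Nat.add_div_left _ hm, pow_succ']
        calc a (s₀ + (m + j)) = a (s₀ + j + m) := by congr 1; ring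
          _ ≤ c * (c ^ (j / m) * D) := h2.trans (by gcongr)
          _ = _ := by ring
  rw [← tendsto_add_atTop_iff_nat s₀]
  have h2 : Tendsto (fun k => c ^ (k / m) * D) atTop (𝓝 0) := by
    simpa using ((tendsto_pow_atTop_nhds_zero_of_lt_one hc0 hc1).comp
      (Nat.tendsto_div_const_atTop hm.ne')).mul_const D
  exact squeeze_zero (fun k => ha _) (fun k => by rw [add_comm]; exact hb k) h2

/-- The product of m consecutive factors tends to `F ^ m`. Choosing m with `F ^ m` small makes the
recursion eventually halve norms over blocks of length m. -/
theorem tendsto_zero_of_mulVec_recursion [DecidableEq ι] {f : ℕ → Matrix ι ι ℝ}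
    {F : Matrix ι ι ℝ} (hf : Tendsto f atTop (𝓝 F))
    (hF : Tendsto (fun j => F ^ j) atTop (𝓝 0)) {q : ℕ → ι → ℝ}
    (hq : ∀ s, q (s + 1) = f s *ᵥ q s) : Tendsto q atTop (𝓝 0) := by
  have hprod : ∀ m, ∃ g : ℕ → Matrix ι ι ℝ, Tendsto g atTop (𝓝 (F ^ m)) ∧
      ∀ s, q (s + m) = g s *ᵥ q s := by
    intro m
    induction m with
    | zero => exact ⟨fun _ => 1, by simp, fun s => by simp⟩
    | succ m ih =>
      obtain ⟨g, hg, hgq⟩ := ih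
      refine ⟨fun s => f (s + m) * g s, ?_, fun s => ?_⟩
      · rw [pow_succ']
        exact ((tendsto_add_atTop_iff_nat m).2 hf).mul hg
      · rw [← add_assoc, hq, hgq, Matrix.mulVec_mulVec]
  -- The sum of absolute entries serves as a continuous bound for the operator norm.
  have hsum : Continuous fun W : Matrix ι ι ℝ => ∑ i, ∑ j, |W i j| := by fun_prop
  have hle : ∀ (W : Matrix ι ι ℝ) (x : ι → ℝ), ‖W *ᵥ x‖ ≤ (∑ i, ∑ j, |W i j|) * ‖x‖ := by
    intro W x
    refine (pi_norm_le_iff_of_nonneg (by positivity)).2 fun i => ?_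
    calc ‖(W *ᵥ x) i‖ ≤ ∑ j, ‖W i j * x j‖ := norm_sum_le _ _
      _ ≤ ∑ j, |W i j| * ‖x‖ := by
          refine Finset.sum_le_sum fun j _ => ?_
          rw [norm_mul]
          exact mul_le_mul_of_nonneg_left (norm_le_pi_norm x j) (abs_nonneg _)
      _ = (∑ j, |W i j|) * ‖x‖ := by rw [Finset.sum_mul]
      _ ≤ _ := by
          exact mul_le_mul_of_nonneg_right (Finset.single_le_sum (f := fun i => ∑ j, |W i j|)
            (fun i _ => by positivity) (Finset.mem_univ i)) (norm_nonneg _)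
  obtain ⟨m, hm, hm0⟩ : ∃ m, (∑ i, ∑ j, |(F ^ m) i j|) < 1 / 2 ∧ 0 < m := by
    have h0 : Tendsto (fun m => ∑ i, ∑ j, |(F ^ m) i j|) atTop (𝓝 0) := by
      simpa [Function.comp_def] using (hsum.tendsto 0).comp hF
    exact ((h0.eventually_lt_const (by norm_num)).and (eventually_gt_atTop 0)).exists
  obtain ⟨g, hg, hgq⟩ := hprod m
  obtain ⟨s₀, hs₀⟩ := eventually_atTop.1 (((hsum.tendsto _).comp hg).eventually_lt_const hm)
  refine tendsto_zero_iff_norm_tendsto_zero.2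
    (tendsto_zero_of_block_contraction (fun _ => norm_nonneg _) (c := 1 / 2) (by norm_num)
      (by norm_num) hm0 (s₀ := s₀) fun s hs => ?_)
  rw [hgq]
  exact (hle _ _).trans (mul_le_mul_of_nonneg_right (hs₀ s hs).le (norm_nonneg _))

end Limits

/-! ### The Riccati recursion from `0` and the algebraic Riccati equation -/

namespace LQProblem

open Topology

variable {n m k N : ℕ} (S : LQProblem n m k N) {lam : ℝ} {P P' : Matrix (Fin n) (Fin n) ℝ}

/-- The Riccati recursion started at `0`. -/
noncomputable def riccatiZero (lam : ℝ) : ℕ → Matrix (Fin n) (Fin n) ℝ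
  | 0 => 0
  | s + 1 => S.riccatiStep lam (riccatiZero lam s)

/-- The closed-loop matrix `(I + Φ P)⁻¹ A`. -/
noncomputable def closedLoop (lam : ℝ) (P : Matrix (Fin n) (Fin n) ℝ) : Matrix (Fin n) (Fin n) ℝ :=
  (1 + S.Φ lam * P)⁻¹ * S.A

theorem quad_riccatiStep (P : Matrix (Fin n) (Fin n) ℝ) (x : Fin n → ℝ) :
    x ⬝ᵥ S.riccatiStep lam P *ᵥ x = x ⬝ᵥ S.Q *ᵥ x +
      (S.A *ᵥ x) ⬝ᵥ ((1 + P * S.Φ lam)⁻¹ * P) *ᵥ (S.A *ᵥ x) := by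
  rw [riccatiStep, Matrix.add_mulVec, dotProduct_add, ← Matrix.mulVec_mulVec, Matrix.mul_assoc,
    ← Matrix.mulVec_mulVec, dotProduct_mulVec_transpose S.Aᵀ, Matrix.transpose_transpose]

theorem transpose_riccatiStep (hQ : S.Q.PosSemidef) (hΦ : (S.Φ lam).PosSemidef)
    (hP : P.PosSemidef) : (S.riccatiStep lam P)ᵀ = S.riccatiStep lam P := by
  rw [riccatiStep, Matrix.mul_assoc S.Aᵀ, Matrix.transpose_add, Matrix.transpose_mul,
    Matrix.transpose_mul, transpose_inv_one_add_mul_mul hP hΦ, posSemidef_transpose hQ,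
    Matrix.transpose_transpose, ← Matrix.mul_assoc]

theorem posSemidef_riccatiStep (hQ : S.Q.PosSemidef) (hΦ : (S.Φ lam).PosSemidef)
    (hP : P.PosSemidef) : (S.riccatiStep lam P).PosSemidef := by
  refine posSemidef_of_quad (S.transpose_riccatiStep hQ hΦ hP) fun x => ?_
  rw [quad_riccatiStep]
  exact add_nonneg (posSemidef_quad_nonneg hQ x) (quad_gain_nonneg hP hΦ _)

theorem quad_riccatiStep_mono (hΦ : (S.Φ lam).PosSemidef) (hP : P.PosSemidef)
    (hP' : P'.PosSemidef) (h : ∀ x, x ⬝ᵥ P *ᵥ x ≤ x ⬝ᵥ P' *ᵥ x) (x : Fin n → ℝ) :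
    x ⬝ᵥ S.riccatiStep lam P *ᵥ x ≤ x ⬝ᵥ S.riccatiStep lam P' *ᵥ x := by
  rw [quad_riccatiStep, quad_riccatiStep]
  gcongr
  exact quad_gain_mono hP hP' hΦ h _

theorem closedLoop_mulVec (hΦ : (S.Φ lam).PosSemidef) (hP : P.PosSemidef) (x : Fin n → ℝ) :
    S.closedLoop lam P *ᵥ x =
      S.A *ᵥ x - S.Φ lam *ᵥ (((1 + P * S.Φ lam)⁻¹ * P) *ᵥ (S.A *ᵥ x)) := by
  rw [closedLoop, inv_one_add_mul_eq_sub hP hΦ, ← Matrix.mulVec_mulVec, Matrix.sub_mulVec,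
    Matrix.one_mulVec, ← Matrix.mulVec_mulVec]

theorem mulVec_closedLoop (hΦ : (S.Φ lam).PosSemidef) (hP : P.PosSemidef) (x : Fin n → ℝ) :
    P *ᵥ (S.closedLoop lam P *ᵥ x) = ((1 + P * S.Φ lam)⁻¹ * P) *ᵥ (S.A *ᵥ x) := by
  rw [S.closedLoop_mulVec hΦ hP, costate_eq hP hΦ]

theorem closedLoop_add (hΦ : (S.Φ lam).PosSemidef) (hP : P.PosSemidef) (x : Fin n → ℝ) :
    S.closedLoop lam P *ᵥ x + S.Φ lam *ᵥ (P *ᵥ (S.closedLoop lam P *ᵥ x)) = S.A *ᵥ x := by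
  rw [S.mulVec_closedLoop hΦ hP, S.closedLoop_mulVec hΦ hP, sub_add_cancel]

theorem transpose_closedLoop (hΦ : (S.Φ lam).PosSemidef) (hP : P.PosSemidef) :
    (S.closedLoop lam P)ᵀ = S.Aᵀ * (1 + P * S.Φ lam)⁻¹ := by
  rw [closedLoop, Matrix.transpose_mul, transpose_inv_one_add_mul (posSemidef_transpose hΦ)
    (posSemidef_transpose hP)]

/-- The Bellman equation evaluated at the minimizer: stage cost, cost-to-go at the closed-loop
successor, and the price of the control that leads there. -/
theorem quad_riccatiStep_closedLoop (hΦ : (S.Φ lam).PosSemidef) (hP : P.PosSemidef)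
    (x : Fin n → ℝ) :
    x ⬝ᵥ S.riccatiStep lam P *ᵥ x = x ⬝ᵥ S.Q *ᵥ x +
      (S.closedLoop lam P *ᵥ x ⬝ᵥ P *ᵥ (S.closedLoop lam P *ᵥ x) +
        P *ᵥ (S.closedLoop lam P *ᵥ x) ⬝ᵥ S.Φ lam *ᵥ (P *ᵥ (S.closedLoop lam P *ᵥ x))) := by
  rw [quad_riccatiStep, quad_gain_eq hP hΦ, S.mulVec_closedLoop hΦ hP, S.closedLoop_mulVec hΦ hP,
    costate_eq hP hΦ]

theorem posSemidef_riccatiZero (hQ : S.Q.PosSemidef) (hΦ : (S.Φ lam).PosSemidef) (s : ℕ) :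
    (S.riccatiZero lam s).PosSemidef := by
  induction s with
  | zero => exact .zero
  | succ s ih => exact S.posSemidef_riccatiStep hQ hΦ ih

theorem monotone_quad_riccatiZero (hQ : S.Q.PosSemidef) (hΦ : (S.Φ lam).PosSemidef)
    (x : Fin n → ℝ) : Monotone fun s => x ⬝ᵥ S.riccatiZero lam s *ᵥ x := by
  refine monotone_nat_of_le_succ fun s => ?_
  induction s generalizing x with
  | zero => simpa [riccatiZero] using posSemidef_quad_nonneg (S.posSemidef_riccatiZero hQ hΦ 1) x
  | succ s ih =>
    exact S.quad_riccatiStep_mono hΦ (S.posSemidef_riccatiZero hQ hΦ s)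
      (S.posSemidef_riccatiZero hQ hΦ (s + 1)) ih x

theorem posSemidef_riccati (hQ : S.Q.PosSemidef) (hQf : S.Qf.PosSemidef)
    (hΦ : (S.Φ lam).PosSemidef) (s : ℕ) : (S.riccati lam s).PosSemidef := by
  induction s with
  | zero => exact hQf
  | succ s ih => exact S.posSemidef_riccatiStep hQ hΦ ih

/-- Carries the penalty condition, stated for the recursion from `Qf`, over to the recursion from 0
and its limit. Convergence from `Qf` is never needed. -/
theorem quad_riccatiZero_le_riccati (hQ : S.Q.PosSemidef) (hQf : S.Qf.PosSemidef)
    (hΦ : (S.Φ lam).PosSemidef) (s : ℕ) (x : Fin n → ℝ) :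
    x ⬝ᵥ S.riccatiZero lam s *ᵥ x ≤ x ⬝ᵥ S.riccati lam s *ᵥ x := by
  induction s generalizing x with
  | zero => simpa [riccatiZero, riccati] using posSemidef_quad_nonneg hQf x
  | succ s ih =>
    exact S.quad_riccatiStep_mono hΦ (S.posSemidef_riccatiZero hQ hΦ s)
      (S.posSemidef_riccati hQ hQf hΦ s) ih x

theorem quad_riccatiZero_le_solution (hQ : S.Q.PosSemidef) (hΦ : (S.Φ lam).PosSemidef)
    (hP : S.IsAREsolution lam P) (s : ℕ) (x : Fin n → ℝ) :
    x ⬝ᵥ S.riccatiZero lam s *ᵥ x ≤ x ⬝ᵥ P *ᵥ x := by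
  induction s generalizing x with
  | zero => simpa [riccatiZero] using posSemidef_quad_nonneg hP.1 x
  | succ s ih =>
    rw [hP.2]
    exact S.quad_riccatiStep_mono hΦ (S.posSemidef_riccatiZero hQ hΦ s) hP.1 ih x

/-- A stabilizing feedback v = Kx is a competitor at every step of the recursion, so its
infinite-horizon cost, dominated by a geometric series, bounds all iterates. -/
theorem exists_quad_riccatiZero_le (hQ : S.Q.PosSemidef) (hstab : S.StabilizabilityCondition lam)
    (x : Fin n → ℝ) : ∃ C, ∀ s, x ⬝ᵥ S.riccatiZero lam s *ᵥ x ≤ C := by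
  obtain ⟨hΦ, K, hK⟩ := hstab
  have hS : (CFC.sqrt (S.Φ lam))ᵀ = CFC.sqrt (S.Φ lam) :=
    posSemidef_transpose (Matrix.nonneg_iff_posSemidef.1 (CFC.sqrt_nonneg _))
  have hSΦ : CFC.sqrt (S.Φ lam) * CFC.sqrt (S.Φ lam) = S.Φ lam :=
    CFC.sqrt_mul_sqrt_self _ (Matrix.nonneg_iff_posSemidef.2 hΦ)
  set M := S.A + CFC.sqrt (S.Φ lam) * K with hM
  -- The stage cost when v = Kx is penalized by vᵀv, as in `quad_gain_le`.
  set W := S.Q + Kᵀ * K with hW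
  have hbound : ∀ s x, x ⬝ᵥ S.riccatiZero lam s *ᵥ x ≤
      ∑ j ∈ Finset.range s, (M ^ j *ᵥ x) ⬝ᵥ W *ᵥ (M ^ j *ᵥ x) := by
    intro s
    induction s with
    | zero => intro x; simp [riccatiZero]
    | succ s ih =>
      intro x
      have h1 := quad_gain_le (S.posSemidef_riccatiZero hQ hΦ s) hΦ hS hSΦ (S.A *ᵥ x) (K *ᵥ x)
      have h2 : S.A *ᵥ x + CFC.sqrt (S.Φ lam) *ᵥ (K *ᵥ x) = M *ᵥ x := by
        rw [hM, Matrix.add_mulVec, Matrix.mulVec_mulVec]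
      have h3 : x ⬝ᵥ W *ᵥ x = x ⬝ᵥ S.Q *ᵥ x + K *ᵥ x ⬝ᵥ K *ᵥ x := by
        rw [hW, Matrix.add_mulVec, dotProduct_add, ← Matrix.mulVec_mulVec,
          dotProduct_mulVec_transpose Kᵀ, Matrix.transpose_transpose]
      rw [h2] at h1
      have h4 := ih (M *ᵥ x)
      rw [riccatiZero, quad_riccatiStep, Finset.sum_range_succ']
      simp only [Matrix.mulVec_mulVec, ← pow_succ, pow_zero, Matrix.one_mulVec] at h4 ⊢
      simp only [Matrix.mulVec_mulVec] at h1 h3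
      linarith
  obtain ⟨C, r, hC, hr0, hr1, hg⟩ := hK.exists_geometric_bound
  obtain ⟨D, hD, hWD⟩ := exists_quad_le W
  have hsum : Summable fun j : ℕ => D * (C * ‖x‖) ^ 2 * (r ^ 2) ^ j :=
    (summable_geometric_of_lt_one (by positivity) (by nlinarith)).mul_left _
  refine ⟨∑' j : ℕ, D * (C * ‖x‖) ^ 2 * (r ^ 2) ^ j, fun s => (hbound s x).trans ?_⟩
  refine le_trans (Finset.sum_le_sum fun j _ => ?_) (hsum.sum_le_tsum _ fun j _ => by positivity)
  calc (M ^ j *ᵥ x) ⬝ᵥ W *ᵥ (M ^ j *ᵥ x) ≤ D * ‖M ^ j *ᵥ x‖ ^ 2 :=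
        (le_abs_self _).trans (hWD _)
    _ ≤ D * (C * r ^ j * ‖x‖) ^ 2 := by gcongr; exact hg j x
    _ = _ := by ring

theorem tendsto_riccatiStep {p : ℕ → Matrix (Fin n) (Fin n) ℝ} (hp : Tendsto p atTop (𝓝 P))
    (hΦ : (S.Φ lam).PosSemidef) (hP : P.PosSemidef) :
    Tendsto (fun s => S.riccatiStep lam (p s)) atTop (𝓝 (S.riccatiStep lam P)) :=
  tendsto_const_nhds.add (((tendsto_const_nhds.mul
    (tendsto_inv_one_add_mul hp (isUnit_one_add_mul hP hΦ))).mul hp).mul tendsto_const_nhds)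

/-- The iterates from 0 increase and are bounded; continuity of the Riccati step makes the limit a
fixed point. -/
theorem exists_tendsto_riccatiZero (hQ : S.Q.PosSemidef)
    (hstab : S.StabilizabilityCondition lam) :
    ∃ P, S.IsAREsolution lam P ∧ Tendsto (S.riccatiZero lam) atTop (𝓝 P) := by
  have hpsd := S.posSemidef_riccatiZero hQ hstab.1
  obtain ⟨P, hP⟩ := exists_tendsto_of_monotone_quad (S.riccatiZero lam)
    (fun s => posSemidef_transpose (hpsd s)) (S.monotone_quad_riccatiZero hQ hstab.1)
    (S.exists_quad_riccatiZero_le hQ hstab)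
  have hsymm : Pᵀ = P := by
    refine tendsto_nhds_unique (((continuous_id.matrix_transpose).tendsto P).comp hP) ?_
    exact hP.congr fun s => (posSemidef_transpose (hpsd s)).symm
  have hPpsd : P.PosSemidef := posSemidef_of_quad hsymm fun x =>
    ge_of_tendsto' (tendsto_dotProduct tendsto_const_nhds (tendsto_mulVec hP tendsto_const_nhds))
      fun s => posSemidef_quad_nonneg (hpsd s) x
  exact ⟨P, ⟨hPpsd, tendsto_nhds_unique ((tendsto_add_atTop_iff_nat 1).2 hP)
    (S.tendsto_riccatiStep hP hstab.1 hPpsd)⟩, hP⟩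

/-! ### The penalty condition and its limit -/

theorem quad_le_of_penaltyCondition (hQ : S.Q.PosSemidef) (hQf : S.Qf.PosSemidef)
    (hΦ : (S.Φ lam).PosSemidef) (hpen : S.PenaltyCondition lam) (s : ℕ) (v : Fin k → ℝ) :
    S.Ξ *ᵥ v ⬝ᵥ S.riccati lam s *ᵥ (S.Ξ *ᵥ v) ≤ lam * (v ⬝ᵥ v) := by
  have hH : (S.Ξᵀ * S.riccati lam s * S.Ξ).PosSemidef := by
    simpa [Matrix.conjTranspose_eq_transpose_of_trivial] using
      (S.posSemidef_riccati hQ hQf hΦ s).conjTranspose_mul_mul_same S.Ξ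
  have hpsd : (algebraMap ℝ _ lam - S.Ξᵀ * S.riccati lam s * S.Ξ).PosSemidef := by
    rw [Matrix.posSemidef_iff_isHermitian_and_spectrum_nonneg]
    refine ⟨?_, ?_⟩
    · refine Matrix.IsHermitian.sub ?_ hH.isHermitian
      rw [Algebra.algebraMap_eq_smul_one]
      simp [Matrix.IsHermitian]
    · rw [← spectrum.singleton_sub_eq]
      rintro _ ⟨_, rfl, e, he, rfl⟩
      exact sub_nonneg.2 (hpen s e he).le
  have h := posSemidef_quad_nonneg hpsd v
  rw [Matrix.sub_mulVec, dotProduct_sub, Algebra.algebraMap_eq_smul_one, Matrix.smul_mulVec,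
    Matrix.one_mulVec, dotProduct_smul, smul_eq_mul, ← Matrix.mulVec_mulVec,
    ← Matrix.mulVec_mulVec, dotProduct_mulVec_transpose, Matrix.transpose_transpose] at h
  linarith

/-- Only the weak inequality survives the limit, so λI - ΞᵀPΞ may be singular. The rest of the proof
works with this weak form and does not use maximizers of the opponent's gain. -/
theorem quad_limit_le (hQ : S.Q.PosSemidef) (hQf : S.Qf.PosSemidef)
    (hΦ : (S.Φ lam).PosSemidef) (hpen : S.PenaltyCondition lam)
    (hP : Tendsto (S.riccatiZero lam) atTop (𝓝 P)) (v : Fin k → ℝ) :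
    S.Ξ *ᵥ v ⬝ᵥ P *ᵥ (S.Ξ *ᵥ v) ≤ lam * (v ⬝ᵥ v) :=
  le_of_tendsto' (tendsto_dotProduct tendsto_const_nhds (tendsto_mulVec hP tendsto_const_nhds))
    fun s => (S.quad_riccatiZero_le_riccati hQ hQf hΦ s _).trans
      (S.quad_le_of_penaltyCondition hQ hQf hΦ hpen s v)

/-! ### Stability of the closed loop -/

section Solution

variable {S}

theorem IsAREsolution.quad_eq (hP : S.IsAREsolution lam P) (hΦ : (S.Φ lam).PosSemidef)
    (x : Fin n → ℝ) :
    x ⬝ᵥ P *ᵥ x = x ⬝ᵥ S.Q *ᵥ x +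
      (S.closedLoop lam P *ᵥ x ⬝ᵥ P *ᵥ (S.closedLoop lam P *ᵥ x) +
        P *ᵥ (S.closedLoop lam P *ᵥ x) ⬝ᵥ S.Φ lam *ᵥ (P *ᵥ (S.closedLoop lam P *ᵥ x))) := by
  rw [← S.quad_riccatiStep_closedLoop hΦ hP.1, ← hP.2]

/-- By the Bellman equation each closed-loop step loses the state cost and the control price, both
nonnegative. -/
theorem IsAREsolution.antitone_quad (hP : S.IsAREsolution lam P) (hQ : S.Q.PosSemidef)
    (hΦ : (S.Φ lam).PosSemidef) (x : Fin n → ℝ) :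
    Antitone fun j => (S.closedLoop lam P ^ j *ᵥ x) ⬝ᵥ P *ᵥ (S.closedLoop lam P ^ j *ᵥ x) := by
  refine antitone_nat_of_succ_le fun j => ?_
  have h := hP.quad_eq hΦ (S.closedLoop lam P ^ j *ᵥ x)
  rw [Matrix.mulVec_mulVec (M := S.closedLoop lam P), ← pow_succ'] at h
  have h1 := posSemidef_quad_nonneg hQ (S.closedLoop lam P ^ j *ᵥ x)
  have h2 := posSemidef_quad_nonneg hΦ (P *ᵥ (S.closedLoop lam P ^ (j + 1) *ᵥ x))
  linarith

/-- If one step of the closed loop does not decrease `xᵀ P x`, it agrees with the free motion. -/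
theorem IsAREsolution.eq_of_quad_le (hP : S.IsAREsolution lam P) (hQ : S.Q.PosSemidef)
    (hΦ : (S.Φ lam).PosSemidef) {x : Fin n → ℝ}
    (h : x ⬝ᵥ P *ᵥ x ≤ S.closedLoop lam P *ᵥ x ⬝ᵥ P *ᵥ (S.closedLoop lam P *ᵥ x)) :
    S.Q *ᵥ x = 0 ∧ S.closedLoop lam P *ᵥ x = S.A *ᵥ x := by
  have h0 := hP.quad_eq hΦ x
  have h1 := posSemidef_quad_nonneg hQ x
  have h2 := posSemidef_quad_nonneg hΦ (P *ᵥ (S.closedLoop lam P *ᵥ x))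
  refine ⟨mulVec_eq_zero_of_quad hQ (by linarith), ?_⟩
  have h3 := mulVec_eq_zero_of_quad hΦ (x := P *ᵥ (S.closedLoop lam P *ᵥ x)) (by linarith)
  have h4 := S.closedLoop_add hΦ hP.1 x
  rwa [h3, add_zero] at h4

/-- No loss over n steps means no loss at any of them. The trajectory is then the free motion `A ^ j
x`, with zero state cost for j < n, and observability gives x = 0. Definiteness of `P`,
invertibility of I - F and stability of the closed loop F all follow from this. -/
theorem IsAREsolution.eq_zero_of_quad_le (hP : S.IsAREsolution lam P) (hQ : S.Q.PosSemidef)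
    (hΦ : (S.Φ lam).PosSemidef) (hobs : S.ObservabilityCondition) {x : Fin n → ℝ}
    (h : x ⬝ᵥ P *ᵥ x ≤ (S.closedLoop lam P ^ n *ᵥ x) ⬝ᵥ P *ᵥ (S.closedLoop lam P ^ n *ᵥ x)) :
    x = 0 := by
  have hanti := hP.antitone_quad hQ hΦ x
  have hstep : ∀ j < n, S.Q *ᵥ (S.closedLoop lam P ^ j *ᵥ x) = 0 ∧
      S.closedLoop lam P *ᵥ (S.closedLoop lam P ^ j *ᵥ x)
        = S.A *ᵥ (S.closedLoop lam P ^ j *ᵥ x) := fun j hj => by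
    refine hP.eq_of_quad_le hQ hΦ ?_
    rw [Matrix.mulVec_mulVec (M := S.closedLoop lam P), ← pow_succ']
    have h1 := hanti (zero_le (a := j))
    have h2 := hanti (Nat.succ_le_of_lt hj)
    simp only [pow_zero, Matrix.one_mulVec] at h1
    exact h1.trans (h.trans h2)
  have hpow : ∀ j ≤ n, S.closedLoop lam P ^ j *ᵥ x = S.A ^ j *ᵥ x := by
    intro j
    induction j with
    | zero => simp
    | succ j ih =>
      intro hj
      have h1 := (hstep j (by omega)).2
      rw [pow_succ', ← Matrix.mulVec_mulVec, h1, ih (by omega), Matrix.mulVec_mulVec, ← pow_succ']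
  refine hobs x fun j hj => ?_
  have h1 := (hstep j hj).1
  rw [hpow j hj.le] at h1
  have hsqrt : (CFC.sqrt S.Q)ᵀ = CFC.sqrt S.Q :=
    posSemidef_transpose (Matrix.nonneg_iff_posSemidef.1 (CFC.sqrt_nonneg _))
  have hmul : CFC.sqrt S.Q * CFC.sqrt S.Q = S.Q :=
    CFC.sqrt_mul_sqrt_self _ (Matrix.nonneg_iff_posSemidef.2 hQ)
  rw [← Matrix.mulVec_mulVec]
  rw [← dotProduct_self_eq_zero, ← dotProduct_mulVec_symm hsqrt, Matrix.mulVec_mulVec, hmul, h1,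
    dotProduct_zero]

theorem IsAREsolution.eq_zero_of_mulVec_eq_zero (hP : S.IsAREsolution lam P)
    (hQ : S.Q.PosSemidef) (hΦ : (S.Φ lam).PosSemidef) (hobs : S.ObservabilityCondition)
    {x : Fin n → ℝ} (h : P *ᵥ x = 0) : x = 0 := by
  refine hP.eq_zero_of_quad_le hQ hΦ hobs ?_
  rw [h, dotProduct_zero]
  exact posSemidef_quad_nonneg hP.1 _

theorem IsAREsolution.isUnit_one_sub (hP : S.IsAREsolution lam P) (hQ : S.Q.PosSemidef)
    (hΦ : (S.Φ lam).PosSemidef) (hobs : S.ObservabilityCondition) :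
    IsUnit (1 - S.closedLoop lam P) := by
  refine isUnit_of_mulVec fun x hx => ?_
  rw [Matrix.sub_mulVec, Matrix.one_mulVec, sub_eq_zero] at hx
  have hpow : ∀ j : ℕ, S.closedLoop lam P ^ j *ᵥ x = x := by
    intro j
    induction j with
    | zero => simp
    | succ j ih => rw [pow_succ', ← Matrix.mulVec_mulVec, ih, ← hx]
  exact hP.eq_zero_of_quad_le hQ hΦ hobs (by rw [hpow])

/-- The n-step loss is a positive definite form, hence at least c‖y‖². The values of xᵀPx along the
trajectory converge, so the losses, and with them the states, tend to 0. -/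
theorem IsAREsolution.tendsto_pow_mulVec (hP : S.IsAREsolution lam P) (hQ : S.Q.PosSemidef)
    (hΦ : (S.Φ lam).PosSemidef) (hobs : S.ObservabilityCondition) (x : Fin n → ℝ) :
    Tendsto (fun j => S.closedLoop lam P ^ j *ᵥ x) atTop (𝓝 0) := by
  set F := S.closedLoop lam P with hF
  have hW : ∀ y, y ⬝ᵥ (P - (F ^ n)ᵀ * P * F ^ n) *ᵥ y
      = y ⬝ᵥ P *ᵥ y - (F ^ n *ᵥ y) ⬝ᵥ P *ᵥ (F ^ n *ᵥ y) := fun y => by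
    rw [Matrix.sub_mulVec, dotProduct_sub, ← Matrix.mulVec_mulVec, ← Matrix.mulVec_mulVec,
      dotProduct_mulVec_transpose (F ^ n)ᵀ, Matrix.transpose_transpose]
  obtain ⟨c, hc, hcle⟩ := exists_pos_le_quad (P - (F ^ n)ᵀ * P * F ^ n) fun y hy => by
    rw [hW]
    by_contra hcon
    exact hy (hP.eq_zero_of_quad_le hQ hΦ hobs (by linarith))
  have hlim := tendsto_atTop_ciInf (hP.antitone_quad hQ hΦ x)
    ⟨0, by rintro _ ⟨j, rfl⟩; exact posSemidef_quad_nonneg hP.1 _⟩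
  have hdiff := hlim.sub ((tendsto_add_atTop_iff_nat n).2 hlim)
  rw [sub_self] at hdiff
  have hsq : Tendsto (fun j => c * ‖F ^ j *ᵥ x‖ ^ 2) atTop (𝓝 0) := by
    refine squeeze_zero (fun j => by positivity) (fun j => ?_) hdiff
    have h := hcle (F ^ j *ᵥ x)
    rw [hW, Matrix.mulVec_mulVec (M := F ^ n), ← pow_add, add_comm n j] at h
    exact h
  rw [tendsto_zero_iff_norm_tendsto_zero]
  have h2 := (hsq.const_mul c⁻¹).sqrt
  simpa [← mul_assoc, inv_mul_cancel₀ hc.ne'] using h2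

theorem IsAREsolution.tendsto_pow (hP : S.IsAREsolution lam P) (hQ : S.Q.PosSemidef)
    (hΦ : (S.Φ lam).PosSemidef) (hobs : S.ObservabilityCondition) :
    Tendsto (fun j => S.closedLoop lam P ^ j) atTop (𝓝 0) := by
  refine tendsto_pi_nhds.2 fun i => tendsto_pi_nhds.2 fun j => ?_
  have h := tendsto_pi_nhds.1 (hP.tendsto_pow_mulVec hQ hΦ hobs (Pi.single j 1)) i
  simpa using h

/-- `P` lies below every solution, because the iterates from 0 do. Conversely, the closed loop of
`P` is a competitor in the Bellman equation of `P'`, so the difference of the two forms does not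
decrease along it; as this loop is stable, the difference is at most its limit 0. -/
theorem IsAREsolution.eq_of_tendsto (hP : S.IsAREsolution lam P) (hQ : S.Q.PosSemidef)
    (hΦ : (S.Φ lam).PosSemidef) (hobs : S.ObservabilityCondition)
    (hlim : Tendsto (S.riccatiZero lam) atTop (𝓝 P)) (hP' : S.IsAREsolution lam P') :
    P' = P := by
  refine eq_of_quad (posSemidef_transpose hP'.1) (posSemidef_transpose hP.1) fun x =>
    le_antisymm ?_ ?_
  · set F := S.closedLoop lam P with hF
    have hstep : ∀ y, y ⬝ᵥ P' *ᵥ y - y ⬝ᵥ P *ᵥ y ≤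
        F *ᵥ y ⬝ᵥ P' *ᵥ (F *ᵥ y) - F *ᵥ y ⬝ᵥ P *ᵥ (F *ᵥ y) := fun y => by
      -- The costate optimal for `P` is used in the problem for `P'`; both then have the same
      -- successor and control price, which cancel.
      have h1 := quad_gain_le_costate hP'.1 hΦ (S.A *ᵥ y) (P *ᵥ (F *ᵥ y))
      rw [← S.closedLoop_add hΦ hP.1 y, add_sub_cancel_right, S.closedLoop_add hΦ hP.1 y] at h1
      have h2 := S.quad_riccatiStep (lam := lam) P' y
      rw [← hP'.2] at h2
      have h3 := hP.quad_eq hΦ y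
      rw [← hF] at h1 h3
      linarith
    have hpow : ∀ j : ℕ, x ⬝ᵥ P' *ᵥ x - x ⬝ᵥ P *ᵥ x ≤
        (F ^ j *ᵥ x) ⬝ᵥ P' *ᵥ (F ^ j *ᵥ x) - (F ^ j *ᵥ x) ⬝ᵥ P *ᵥ (F ^ j *ᵥ x) := by
      intro j
      induction j with
      | zero => simp
      | succ j ih =>
        refine ih.trans ((hstep _).trans_eq ?_)
        rw [Matrix.mulVec_mulVec (M := F), ← pow_succ']
    have hx := hP.tendsto_pow_mulVec hQ hΦ hobs x
    have h0 := (tendsto_dotProduct hx (tendsto_mulVec (tendsto_const_nhds (x := P')) hx)).sub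
      (tendsto_dotProduct hx (tendsto_mulVec (tendsto_const_nhds (x := P)) hx))
    simp only [zero_dotProduct, sub_zero] at h0
    exact sub_nonpos.1 (ge_of_tendsto' h0 hpow)
  · exact le_of_tendsto'
      (tendsto_dotProduct tendsto_const_nhds (tendsto_mulVec hlim tendsto_const_nhds))
      fun s => S.quad_riccatiZero_le_solution hQ hΦ hP' s x

end Solution

end LQProblem

/-! ### The saddle point of one stage -/

namespace LQProblem

open Topology

variable {n m k N : ℕ} (S : LQProblem n m k N) {lam : ℝ} {P : Matrix (Fin n) (Fin n) ℝ}

/-- The quadratic function `y ↦ yᵀ P y + 2 rᵀ y`. -/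
def value (P : Matrix (Fin n) (Fin n) ℝ) (r y : Fin n → ℝ) : ℝ :=
  y ⬝ᵥ P *ᵥ y + 2 * (r ⬝ᵥ y)

/-- The costate at the saddle point of a stage started at `x` with cost-to-go `value P r`. -/
noncomputable def costate (lam : ℝ) (P : Matrix (Fin n) (Fin n) ℝ) (r x : Fin n → ℝ) : Fin n → ℝ :=
  (1 + P * S.Φ lam)⁻¹ *ᵥ (P *ᵥ (S.A *ᵥ x + S.Ξ *ᵥ S.wbar) + r)

/-- The backward step of the linear term of the cost-to-go. -/
noncomputable def linearStep (lam : ℝ) (P : Matrix (Fin n) (Fin n) ℝ) (r : Fin n → ℝ) :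
    Fin n → ℝ :=
  (S.Aᵀ * (1 + P * S.Φ lam)⁻¹) *ᵥ (P *ᵥ (S.Ξ *ᵥ S.wbar) + r)

/-- The constant added to the cost-to-go by one stage with the disturbance `w̄`. -/
noncomputable def stageConst (lam : ℝ) (P : Matrix (Fin n) (Fin n) ℝ) (r : Fin n → ℝ) : ℝ :=
  S.Ξ *ᵥ S.wbar ⬝ᵥ ((1 + P * S.Φ lam)⁻¹ * P) *ᵥ (S.Ξ *ᵥ S.wbar)
    + 2 * ((1 + P * S.Φ lam)⁻¹ *ᵥ r ⬝ᵥ S.Ξ *ᵥ S.wbar)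
    - r ⬝ᵥ S.Φ lam *ᵥ ((1 + P * S.Φ lam)⁻¹ *ᵥ r)

/-- The gain of the opponent from the deviation `δ` against the sample point `v`. -/
noncomputable def deviationGain (lam : ℝ) (P : Matrix (Fin n) (Fin n) ℝ) (δ v : Fin k → ℝ) : ℝ :=
  S.Ξ *ᵥ δ ⬝ᵥ P *ᵥ (S.Ξ *ᵥ δ) - lam * ((δ - (v - S.wbar)) ⬝ᵥ (δ - (v - S.wbar)))

theorem value_add (hP : Pᵀ = P) (r z d : Fin n → ℝ) :
    value P r (z + d) = value P r z + 2 * ((P *ᵥ z + r) ⬝ᵥ d) + d ⬝ᵥ P *ᵥ d := by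
  rw [value, value, quad_add hP, dotProduct_add, add_dotProduct]
  ring

/-- The costate is half the gradient of the cost-to-go at the saddle-point successor. This
first-order condition removes the linear terms in `stage_identity`. -/
theorem costate_eq_add (hΦ : (S.Φ lam).PosSemidef) (hP : P.PosSemidef) (r x : Fin n → ℝ) :
    S.costate lam P r x =
      P *ᵥ (S.A *ᵥ x + S.Ξ *ᵥ S.wbar - S.Φ lam *ᵥ S.costate lam P r x) + r := by
  have h := inv_one_add_mul_mulVec (isUnit_one_add_mul hP hΦ)
    (P *ᵥ (S.A *ᵥ x + S.Ξ *ᵥ S.wbar) + r)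
  rw [Matrix.mulVec_sub, costate, sub_add_eq_add_sub]
  exact eq_sub_of_add_eq h

theorem value_at_saddle (hΦ : (S.Φ lam).PosSemidef) (hP : P.PosSemidef) (r y p : Fin n → ℝ)
    (hp : p = (1 + P * S.Φ lam)⁻¹ *ᵥ (P *ᵥ y + r)) :
    value P r (y - S.Φ lam *ᵥ p) + p ⬝ᵥ S.Φ lam *ᵥ p =
      y ⬝ᵥ ((1 + P * S.Φ lam)⁻¹ * P) *ᵥ y + 2 * ((1 + P * S.Φ lam)⁻¹ *ᵥ r ⬝ᵥ y)
        - r ⬝ᵥ S.Φ lam *ᵥ ((1 + P * S.Φ lam)⁻¹ *ᵥ r) := by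
  have hpeq : P *ᵥ (y - S.Φ lam *ᵥ p) = p - r := by
    have h := inv_one_add_mul_mulVec (isUnit_one_add_mul hP hΦ) (P *ᵥ y + r)
    rw [← hp] at h
    rw [Matrix.mulVec_sub, sub_eq_sub_iff_add_eq_add, ← h, add_comm]
  have hsplit : p = ((1 + P * S.Φ lam)⁻¹ * P) *ᵥ y + (1 + P * S.Φ lam)⁻¹ *ᵥ r := by
    rw [hp, Matrix.mulVec_add, Matrix.mulVec_mulVec]
  have hMr : (1 + P * S.Φ lam)⁻¹ *ᵥ r ⬝ᵥ y
      = r ⬝ᵥ y - r ⬝ᵥ S.Φ lam *ᵥ (((1 + P * S.Φ lam)⁻¹ * P) *ᵥ y) := by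
    have h := dotProduct_mulVec_transpose ((1 + P * S.Φ lam)⁻¹)ᵀ r y
    rw [Matrix.transpose_transpose] at h
    rw [← h, transpose_inv_one_add_mul (posSemidef_transpose hP) (posSemidef_transpose hΦ),
      inv_one_add_mul_eq_sub hP hΦ, Matrix.sub_mulVec, Matrix.one_mulVec, dotProduct_sub,
      Matrix.mulVec_mulVec]
  have h1 : r ⬝ᵥ S.Φ lam *ᵥ p = r ⬝ᵥ S.Φ lam *ᵥ (((1 + P * S.Φ lam)⁻¹ * P) *ᵥ y)
      + r ⬝ᵥ S.Φ lam *ᵥ ((1 + P * S.Φ lam)⁻¹ *ᵥ r) := by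
    nth_rw 1 [hsplit]
    rw [Matrix.mulVec_add, dotProduct_add]
  have h2 : y ⬝ᵥ p = y ⬝ᵥ ((1 + P * S.Φ lam)⁻¹ * P) *ᵥ y
      + (1 + P * S.Φ lam)⁻¹ *ᵥ r ⬝ᵥ y := by
    nth_rw 1 [hsplit]
    rw [dotProduct_add, dotProduct_comm y ((1 + P * S.Φ lam)⁻¹ *ᵥ r)]
  have h3 := dotProduct_comm (S.Φ lam *ᵥ p) p
  rw [value, hpeq, dotProduct_sub, dotProduct_comm _ r, dotProduct_sub, sub_dotProduct]
  linarith

theorem value_step (hΦ : (S.Φ lam).PosSemidef) (hP : P.PosSemidef) (r x : Fin n → ℝ) :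
    x ⬝ᵥ S.Q *ᵥ x
        + (value P r (S.A *ᵥ x + S.Ξ *ᵥ S.wbar - S.Φ lam *ᵥ S.costate lam P r x)
        + S.costate lam P r x ⬝ᵥ S.Φ lam *ᵥ S.costate lam P r x) =
      value (S.riccatiStep lam P) (S.linearStep lam P r) x + S.stageConst lam P r := by
  rw [S.value_at_saddle hΦ hP r (S.A *ᵥ x + S.Ξ *ᵥ S.wbar) (S.costate lam P r x) rfl, quad_add (transpose_inv_one_add_mul_mul hP hΦ),
    value, quad_riccatiStep, linearStep, stageConst]
  have h1 := dotProduct_mulVec_transpose S.A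
    ((1 + P * S.Φ lam)⁻¹ *ᵥ (P *ᵥ (S.Ξ *ᵥ S.wbar) + r)) x
  rw [Matrix.mulVec_mulVec (M := S.Aᵀ)] at h1
  rw [← h1, Matrix.mulVec_add, add_dotProduct, dotProduct_add,
    Matrix.mulVec_mulVec (v := S.Ξ *ᵥ S.wbar),
    ← dotProduct_mulVec_symm (transpose_inv_one_add_mul_mul hP hΦ) (S.A *ᵥ x),
    dotProduct_comm (((1 + P * S.Φ lam)⁻¹ * P) *ᵥ (S.Ξ *ᵥ S.wbar)) (S.A *ᵥ x)]
  ring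

/-- The stage cost at controls and disturbances written as deviations `e`, `δ` from the saddle
point. -/
theorem stage_identity (hΦ : (S.Φ lam).PosSemidef) (hP : P.PosSemidef) (hR : S.R.PosDef)
    (hlam : 0 < lam) (r x : Fin n → ℝ) (e : Fin m → ℝ) (δ v : Fin k → ℝ)
    {u : Fin m → ℝ} (hu : u = e - S.R⁻¹ *ᵥ (S.Bᵀ *ᵥ S.costate lam P r x))
    {w : Fin k → ℝ} (hw : w = S.wbar + lam⁻¹ • (S.Ξᵀ *ᵥ S.costate lam P r x) + δ) :
    value P r (S.next x u w) + (x ⬝ᵥ S.Q *ᵥ x + u ⬝ᵥ S.R *ᵥ u) - lam * ((w - v) ⬝ᵥ (w - v)) =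
      value (S.riccatiStep lam P) (S.linearStep lam P r) x + S.stageConst lam P r
        + 2 * (S.costate lam P r x ⬝ᵥ S.Ξ *ᵥ (v - S.wbar))
        + (S.B *ᵥ e ⬝ᵥ P *ᵥ (S.B *ᵥ e) + 2 * (P *ᵥ (S.B *ᵥ e) ⬝ᵥ S.Ξ *ᵥ δ) + e ⬝ᵥ S.R *ᵥ e)
        + S.deviationGain lam P δ v := by
  have hstep := S.value_step hΦ hP r x
  have hp := S.costate_eq_add hΦ hP r x
  set p := S.costate lam P r x
  set z := S.A *ᵥ x + S.Ξ *ᵥ S.wbar - S.Φ lam *ᵥ p with hz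
  have hRinv : S.R * S.R⁻¹ = 1 :=
    Matrix.mul_nonsing_inv _ ((Matrix.isUnit_iff_isUnit_det _).1 hR.isUnit)
  have hRsymm := posSemidef_transpose hR.posSemidef
  -- The saddle control contributes -BR⁻¹Bᵀp and the saddle disturbance +λ⁻¹ΞΞᵀp to the successor,
  -- together -Φp.
  have hΦp : S.Φ lam *ᵥ p = S.B *ᵥ (S.R⁻¹ *ᵥ (S.Bᵀ *ᵥ p)) - lam⁻¹ • (S.Ξ *ᵥ (S.Ξᵀ *ᵥ p)) := by
    simp only [Φ, Matrix.sub_mulVec, Matrix.smul_mulVec, Matrix.mulVec_mulVec, Matrix.mul_assoc]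
  have hnext : S.next x u w = z + (S.B *ᵥ e + S.Ξ *ᵥ δ) := by
    rw [next, hz, hΦp, hu, hw, Matrix.mulVec_sub, Matrix.mulVec_add, Matrix.mulVec_add,
      Matrix.mulVec_smul]
    abel
  have hcost : u ⬝ᵥ S.R *ᵥ u = e ⬝ᵥ S.R *ᵥ e - 2 * (p ⬝ᵥ S.B *ᵥ e)
      + p ⬝ᵥ S.B *ᵥ (S.R⁻¹ *ᵥ (S.Bᵀ *ᵥ p)) := by
    have h1 : S.R *ᵥ (S.R⁻¹ *ᵥ (S.Bᵀ *ᵥ p)) = S.Bᵀ *ᵥ p := by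
      rw [Matrix.mulVec_mulVec, hRinv, Matrix.one_mulVec]
    rw [hu, Matrix.mulVec_sub, h1, sub_dotProduct, dotProduct_sub, dotProduct_sub,
      dotProduct_mulVec_symm hRsymm (S.R⁻¹ *ᵥ (S.Bᵀ *ᵥ p)), h1, dotProduct_comm e (S.Bᵀ *ᵥ p),
      dotProduct_comm (S.R⁻¹ *ᵥ (S.Bᵀ *ᵥ p)), dotProduct_mulVec_transpose S.B p,
      dotProduct_mulVec_transpose S.B p]
    ring
  have hpen : lam * ((w - v) ⬝ᵥ (w - v)) = lam⁻¹ * (p ⬝ᵥ S.Ξ *ᵥ (S.Ξᵀ *ᵥ p))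
      + 2 * (p ⬝ᵥ S.Ξ *ᵥ δ) - 2 * (p ⬝ᵥ S.Ξ *ᵥ (v - S.wbar))
      + lam * ((δ - (v - S.wbar)) ⬝ᵥ (δ - (v - S.wbar))) := by
    have h1 : w - v = lam⁻¹ • (S.Ξᵀ *ᵥ p) + (δ - (v - S.wbar)) := by rw [hw]; abel
    have h2 : p ⬝ᵥ S.Ξ *ᵥ δ - p ⬝ᵥ S.Ξ *ᵥ (v - S.wbar)
        = S.Ξᵀ *ᵥ p ⬝ᵥ (δ - (v - S.wbar)) := by
      rw [← dotProduct_mulVec_transpose, Matrix.mulVec_sub S.Ξ δ, dotProduct_sub]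
    rw [h1, add_dotProduct, dotProduct_add, dotProduct_add, dotProduct_mulVec_transpose S.Ξ p
      (S.Ξᵀ *ᵥ p), smul_dotProduct, dotProduct_smul, dotProduct_comm _ (lam⁻¹ • (S.Ξᵀ *ᵥ p)),
      smul_dotProduct, smul_eq_mul, smul_eq_mul, smul_eq_mul]
    have h3 : lam * lam⁻¹ = 1 := mul_inv_cancel₀ hlam.ne'
    linear_combination (lam⁻¹ * (S.Ξᵀ *ᵥ p ⬝ᵥ S.Ξᵀ *ᵥ p)
      + 2 * (S.Ξᵀ *ᵥ p ⬝ᵥ (δ - (v - S.wbar)))) * h3 - 2 * h2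
  have hpΦ : p ⬝ᵥ S.Φ lam *ᵥ p = p ⬝ᵥ S.B *ᵥ (S.R⁻¹ *ᵥ (S.Bᵀ *ᵥ p))
      - lam⁻¹ * (p ⬝ᵥ S.Ξ *ᵥ (S.Ξᵀ *ᵥ p)) := by
    rw [hΦp, dotProduct_sub, dotProduct_smul, smul_eq_mul]
  -- The first-order terms 2p·(Be + Ξδ) of the cost-to-go cancel against those of the control cost
  -- and of the penalty; only 2p·Ξ(v - w̄) remains.
  rw [hnext, value_add (posSemidef_transpose hP), ← hp, quad_add (posSemidef_transpose hP),
    dotProduct_add, hcost, hpen, ← hstep, hpΦ, deviationGain]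
  ring

theorem sum_sample_sub_wbar (hN : 0 < N) : ∑ i, (S.sample i - S.wbar) = 0 := by
  have : (N : ℝ) ≠ 0 := by positivity
  simp only [wbar, Finset.sum_sub_distrib, Finset.sum_const, Finset.card_univ, Fintype.card_fin]
  rw [← Nat.cast_smul_eq_nsmul ℝ, smul_smul, mul_inv_cancel₀ this, one_smul, sub_self]

/-- The disturbance played against the `i`-th sample point, with deviation `d` from the saddle
point. -/
noncomputable def disturbance (lam : ℝ) (P : Matrix (Fin n) (Fin n) ℝ) (r : Fin n → ℝ)
    (d : Fin k → ℝ) (x : Fin n → ℝ) : Fin k → ℝ :=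
  S.wbar + lam⁻¹ • (S.Ξᵀ *ᵥ S.costate lam P r x) + d

/-- Against the saddle-point disturbances no control gets below the saddle value. -/
theorem le_stage_average (hN : 0 < N) (hΦ : (S.Φ lam).PosSemidef) (hP : P.PosSemidef)
    (hR : S.R.PosDef) (hlam : 0 < lam) (r x : Fin n → ℝ) (u : Fin m → ℝ)
    {δ : Fin N → Fin k → ℝ} (hδ : ∑ i, δ i = 0) :
    value (S.riccatiStep lam P) (S.linearStep lam P r) x + (S.stageConst lam P r
        + (N : ℝ)⁻¹ * ∑ i, S.deviationGain lam P (δ i) (S.sample i)) ≤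
      (x ⬝ᵥ S.Q *ᵥ x + u ⬝ᵥ S.R *ᵥ u)
        - lam * ((N : ℝ)⁻¹ * ∑ i, (S.disturbance lam P r (δ i) x - S.sample i) ⬝ᵥ
            (S.disturbance lam P r (δ i) x - S.sample i))
        + (N : ℝ)⁻¹ * ∑ i, value P r (S.next x u (S.disturbance lam P r (δ i) x)) := by
  have hN' : (N : ℝ) ≠ 0 := by positivity
  set e := u + S.R⁻¹ *ᵥ (S.Bᵀ *ᵥ S.costate lam P r x) with he
  have hid := fun i => S.stage_identity hΦ hP hR hlam r x e (δ i) (S.sample i)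
    (u := u) (by rw [he]; abel) (w := S.disturbance lam P r (δ i) x) rfl
  have hsum := Finset.sum_congr rfl fun i (_ : i ∈ Finset.univ) => hid i
  -- The two terms of the stage identity that carry no sign vanish on averaging: one since the
  -- centred samples sum to zero, the other since the deviations do.
  have h1 : ∑ i, S.costate lam P r x ⬝ᵥ S.Ξ *ᵥ (S.sample i - S.wbar) = 0 := by
    rw [← dotProduct_sum, ← Matrix.mulVec_sum, S.sum_sample_sub_wbar hN, Matrix.mulVec_zero,
      dotProduct_zero]
  have h2 : ∑ i, P *ᵥ (S.B *ᵥ e) ⬝ᵥ S.Ξ *ᵥ δ i = 0 := by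
    rw [← dotProduct_sum, ← Matrix.mulVec_sum, hδ, Matrix.mulVec_zero, dotProduct_zero]
  have h3 := posSemidef_quad_nonneg hP (S.B *ᵥ e)
  have h4 := posSemidef_quad_nonneg hR.posSemidef e
  simp only [Finset.sum_add_distrib, Finset.sum_sub_distrib, Finset.sum_const, Finset.card_univ,
    Fintype.card_fin, nsmul_eq_mul, ← Finset.mul_sum, h1, h2] at hsum
  have h5 : (N : ℝ)⁻¹ * N = 1 := inv_mul_cancel₀ hN'
  rw [← sub_nonneg]
  have h6 : 0 ≤ S.B *ᵥ e ⬝ᵥ P *ᵥ (S.B *ᵥ e) + e ⬝ᵥ S.R *ᵥ e := add_nonneg h3 h4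
  refine h6.trans_eq ?_
  linear_combination (-(N : ℝ)⁻¹) * hsum + (x ⬝ᵥ S.Q *ᵥ x + u ⬝ᵥ S.R *ᵥ u
    - value (S.riccatiStep lam P) (S.linearStep lam P r) x - S.stageConst lam P r
    - S.B *ᵥ e ⬝ᵥ P *ᵥ (S.B *ᵥ e) - e ⬝ᵥ S.R *ᵥ e) * h5

/-! ### Convergence of the linear terms -/

/-- The linear terms of the cost-to-go for the Riccati recursion from `0`. -/
noncomputable def linearZero (lam : ℝ) : ℕ → Fin n → ℝ
  | 0 => 0
  | s + 1 => S.linearStep lam (S.riccatiZero lam s) (linearZero lam s)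

theorem rss_eq_linearStep (h : IsUnit (1 - S.Aᵀ * (1 + P * S.Φ lam)⁻¹)) :
    S.linearStep lam P (S.rss lam P) = S.rss lam P := by
  have h1 : (1 - S.Aᵀ * (1 + P * S.Φ lam)⁻¹) *ᵥ S.rss lam P =
      (S.Aᵀ * (1 + P * S.Φ lam)⁻¹ * P * S.Ξ) *ᵥ S.wbar := by
    rw [rss, Matrix.mulVec_mulVec, Matrix.mul_nonsing_inv _
      ((Matrix.isUnit_iff_isUnit_det _).1 h), Matrix.one_mulVec]
  rw [Matrix.sub_mulVec, Matrix.one_mulVec, sub_eq_iff_eq_add] at h1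
  conv_rhs => rw [h1]
  rw [linearStep, Matrix.mulVec_add, Matrix.mulVec_mulVec, Matrix.mulVec_mulVec, Matrix.mul_assoc _ P]

/-- The recursion is affine with varying coefficients. An equilibrium (x, p) of the state and
adjoint equations makes it homogeneous: rₛ - p + Pₛx is multiplied by Aᵀ(I + PₛΦ)⁻¹ at each step,
which tends to the transpose of the stable closed loop. So rₛ tends to p - Px = r_ss. -/
theorem tendsto_linearZero (hQ : S.Q.PosSemidef) (hΦ : (S.Φ lam).PosSemidef)
    (hobs : S.ObservabilityCondition) (hP : S.IsAREsolution lam P)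
    (hlim : Tendsto (S.riccatiZero lam) atTop (𝓝 P)) :
    Tendsto (S.linearZero lam) atTop (𝓝 (S.rss lam P)) := by
  have hunit := hP.isUnit_one_sub hQ hΦ hobs
  have hunit' : IsUnit (1 - S.Aᵀ * (1 + P * S.Φ lam)⁻¹) := by
    rw [← S.transpose_closedLoop hΦ hP.1, ← Matrix.transpose_one, ← Matrix.transpose_sub]
    exact (Matrix.isUnit_transpose _).2 hunit
  have hr := S.rss_eq_linearStep hunit'
  set r := S.rss lam P
  -- The equilibrium state of the closed loop under the mean disturbance.
  set x := (1 - S.closedLoop lam P)⁻¹ *ᵥ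
    (S.Ξ *ᵥ S.wbar - S.Φ lam *ᵥ ((1 + P * S.Φ lam)⁻¹ *ᵥ (P *ᵥ (S.Ξ *ᵥ S.wbar) + r))) with hx
  set p := S.costate lam P r x with hp
  have hpsplit : p = ((1 + P * S.Φ lam)⁻¹ * P) *ᵥ (S.A *ᵥ x)
      + (1 + P * S.Φ lam)⁻¹ *ᵥ (P *ᵥ (S.Ξ *ᵥ S.wbar) + r) := by
    rw [hp, costate, Matrix.mulVec_add P, add_assoc, Matrix.mulVec_add, Matrix.mulVec_mulVec]
  have hxeq : x = S.A *ᵥ x + S.Ξ *ᵥ S.wbar - S.Φ lam *ᵥ p := by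
    have h1 : (1 - S.closedLoop lam P) *ᵥ x = S.Ξ *ᵥ S.wbar
        - S.Φ lam *ᵥ ((1 + P * S.Φ lam)⁻¹ *ᵥ (P *ᵥ (S.Ξ *ᵥ S.wbar) + r)) := by
      rw [hx, Matrix.mulVec_mulVec, Matrix.mul_nonsing_inv _
        ((Matrix.isUnit_iff_isUnit_det _).1 hunit), Matrix.one_mulVec]
    rw [Matrix.sub_mulVec, Matrix.one_mulVec, S.closedLoop_mulVec hΦ hP.1, sub_eq_iff_eq_add] at h1
    rw [hpsplit, Matrix.mulVec_add]
    conv_lhs => rw [h1]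
    abel
  have hpeq : p = P *ᵥ x + r := by
    have := S.costate_eq_add hΦ hP.1 r x
    rwa [← hp, ← hxeq] at this
  -- The adjoint equation at the equilibrium, obtained by adding the Riccati equation at `x` to the
  -- fixed-point equation of `r`.
  have hstat : p = S.Q *ᵥ x + S.Aᵀ *ᵥ p := by
    have h1 : P *ᵥ x = S.Q *ᵥ x + S.Aᵀ *ᵥ (((1 + P * S.Φ lam)⁻¹ * P) *ᵥ (S.A *ᵥ x)) := by
      conv_lhs => rw [hP.2]
      simp only [riccatiStep, Matrix.add_mulVec, Matrix.mulVec_mulVec, Matrix.mul_assoc]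
    rw [linearStep, ← Matrix.mulVec_mulVec] at hr
    nth_rw 2 [hpsplit]
    rw [Matrix.mulVec_add, hr, ← add_assoc, ← h1, ← hpeq]
  set q : ℕ → Fin n → ℝ := fun s => S.linearZero lam s - p + S.riccatiZero lam s *ᵥ x with hqdef
  have hq : ∀ s, q (s + 1) = (S.Aᵀ * (1 + S.riccatiZero lam s * S.Φ lam)⁻¹) *ᵥ q s := fun s => by
    have hu := (Matrix.isUnit_iff_isUnit_det _).1
      (isUnit_one_add_mul (S.posSemidef_riccatiZero hQ hΦ s) hΦ)
    simp only [hqdef, linearZero, riccatiZero]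
    set Ps := S.riccatiZero lam s
    have h1 : S.Aᵀ *ᵥ p = (S.Aᵀ * (1 + Ps * S.Φ lam)⁻¹) *ᵥ (p + Ps *ᵥ (S.Φ lam *ᵥ p)) := by
      have : p + Ps *ᵥ (S.Φ lam *ᵥ p) = (1 + Ps * S.Φ lam) *ᵥ p := by
        rw [Matrix.add_mulVec, Matrix.one_mulVec, Matrix.mulVec_mulVec]
      rw [this, Matrix.mulVec_mulVec, Matrix.mul_assoc, Matrix.nonsing_inv_mul _ hu,
        Matrix.mul_one]
    have h2 : S.riccatiStep lam Ps *ᵥ x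
        = S.Q *ᵥ x + (S.Aᵀ * (1 + Ps * S.Φ lam)⁻¹) *ᵥ (Ps *ᵥ (S.A *ᵥ x)) := by
      simp only [riccatiStep, Matrix.add_mulVec, Matrix.mulVec_mulVec, Matrix.mul_assoc]
    have h3 : Ps *ᵥ x = Ps *ᵥ (S.A *ᵥ x) + Ps *ᵥ (S.Ξ *ᵥ S.wbar) - Ps *ᵥ (S.Φ lam *ᵥ p) := by
      rw [← Matrix.mulVec_add, ← Matrix.mulVec_sub, ← hxeq]
    have h4 : p = S.Q *ᵥ x
        + (S.Aᵀ * (1 + Ps * S.Φ lam)⁻¹) *ᵥ (p + Ps *ᵥ (S.Φ lam *ᵥ p)) := by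
      rw [← h1, ← hstat]
    rw [linearStep, h2, h3]
    nth_rw 1 [h4]
    simp only [Matrix.mulVec_add, Matrix.mulVec_sub]
    abel
  have hF : Tendsto (fun s => S.Aᵀ * (1 + S.riccatiZero lam s * S.Φ lam)⁻¹) atTop
      (𝓝 (S.closedLoop lam P)ᵀ) := by
    rw [S.transpose_closedLoop hΦ hP.1]
    exact tendsto_const_nhds.mul (tendsto_inv_one_add_mul hlim (isUnit_one_add_mul hP.1 hΦ))
  have hFpow : Tendsto (fun j => (S.closedLoop lam P)ᵀ ^ j) atTop (𝓝 0) := by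
    have h := ((continuous_id.matrix_transpose).tendsto 0).comp (hP.tendsto_pow hQ hΦ hobs)
    simpa [Function.comp_def, Matrix.transpose_pow] using h
  have hq0 := tendsto_zero_of_mulVec_recursion hF hFpow hq
  have h := (hq0.add (tendsto_const_nhds (x := p))).sub
    (tendsto_mulVec hlim (tendsto_const_nhds (x := x)))
  have hr' : r = 0 + p - P *ᵥ x := by rw [hpeq]; abel
  rw [hr']
  refine h.congr fun s => ?_
  simp only [hqdef]
  abel

theorem tendsto_stageConst (hΦ : (S.Φ lam).PosSemidef) (hP : P.PosSemidef)
    {p : ℕ → Matrix (Fin n) (Fin n) ℝ} (hp : Tendsto p atTop (𝓝 P)) {r : ℕ → Fin n → ℝ}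
    {r₀ : Fin n → ℝ} (hr : Tendsto r atTop (𝓝 r₀)) :
    Tendsto (fun s => S.stageConst lam (p s) (r s)) atTop (𝓝 (S.stageConst lam P r₀)) := by
  have hM := tendsto_inv_one_add_mul hp (isUnit_one_add_mul hP hΦ)
  have hMr := tendsto_mulVec hM hr
  exact ((tendsto_dotProduct tendsto_const_nhds (tendsto_mulVec (hM.mul hp)
    tendsto_const_nhds)).add ((tendsto_dotProduct hMr tendsto_const_nhds).const_mul 2)).sub
    (tendsto_dotProduct hr (tendsto_mulVec tendsto_const_nhds hMr))

theorem tendsto_deviationGain {p : ℕ → Matrix (Fin n) (Fin n) ℝ} (hp : Tendsto p atTop (𝓝 P))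
    (δ v : Fin k → ℝ) :
    Tendsto (fun s => S.deviationGain lam (p s) δ v) atTop (𝓝 (S.deviationGain lam P δ v)) :=
  (tendsto_dotProduct tendsto_const_nhds (tendsto_mulVec hp tendsto_const_nhds)).sub
    tendsto_const_nhds

/-- The minimum is at -P⁻¹r. This is what lets the bias be dropped from the average cost. -/
theorem exists_le_value (hP : P.PosSemidef) (hinj : ∀ x, P *ᵥ x = 0 → x = 0) (r : Fin n → ℝ) :
    ∃ C, ∀ x, C ≤ value P r x := by
  have hu := (Matrix.isUnit_iff_isUnit_det _).1 (isUnit_of_mulVec hinj)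
  refine ⟨value P r (-(P⁻¹ *ᵥ r)), fun x => ?_⟩
  have h := value_add (posSemidef_transpose hP) r (-(P⁻¹ *ᵥ r)) (x + P⁻¹ *ᵥ r)
  have h1 : P *ᵥ (-(P⁻¹ *ᵥ r)) + r = 0 := by
    rw [Matrix.mulVec_neg, Matrix.mulVec_mulVec, Matrix.mul_nonsing_inv _ hu, Matrix.one_mulVec,
      neg_add_cancel]
  have h2 : -(P⁻¹ *ᵥ r) + (x + P⁻¹ *ᵥ r) = x := by abel
  rw [h1, h2, zero_dotProduct] at h
  have := posSemidef_quad_nonneg hP (x + P⁻¹ *ᵥ r)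
  linarith

end LQProblem

/-! ### Integration along trajectories -/

section Measure

theorem eexp_coe {Ω : Type*} [MeasurableSpace Ω] {P : Measure Ω} {f : Ω → ℝ}
    (hf : Integrable f P) : eexp P (fun ω => (f ω : EReal)) = ((∫ ω, f ω ∂P : ℝ) : EReal) := by
  have h1 : ∫⁻ ω, ENNReal.ofReal (f ω) ∂P ≠ ∞ :=
    ((lintegral_mono fun ω => Real.ofReal_le_enorm (f ω)).trans_lt hf.2).ne
  have h2 : ∫⁻ ω, ENNReal.ofReal (-f ω) ∂P ≠ ∞ :=
    ((lintegral_mono fun ω => Real.ofReal_le_enorm (-f ω)).trans_lt hf.neg.2).ne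
  rw [integral_eq_lintegral_pos_part_sub_lintegral_neg_part hf, EReal.coe_sub,
    EReal.coe_ennreal_toReal h1, EReal.coe_ennreal_toReal h2]
  simp only [eexp, EReal.real_coe_toENNReal, ← EReal.coe_neg]

/-- Holds without measurability, so the Wasserstein penalty along a trajectory can be replaced by a
measurable upper bound. -/
theorem eexp_mono {Ω : Type*} [MeasurableSpace Ω] {P : Measure Ω} {f g : Ω → EReal}
    (h : ∀ ω, f ω ≤ g ω) : eexp P f ≤ eexp P g := by
  refine EReal.sub_le_sub ?_ ?_
  · exact EReal.coe_ennreal_le_coe_ennreal_iff.2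
      (lintegral_mono fun ω => EReal.toENNReal_le_toENNReal (h ω))
  · exact EReal.coe_ennreal_le_coe_ennreal_iff.2
      (lintegral_mono fun ω => EReal.toENNReal_le_toENNReal (EReal.neg_le_neg_iff.2 (h ω)))

theorem integral_bind_kernel {X Y : Type*} [MeasurableSpace X] [MeasurableSpace Y]
    {μ : Measure X} {κ : Kernel X Y} {f : Y → ℝ} (hf : Integrable f (μ.bind κ)) :
    ∫ y, f y ∂(μ.bind κ) = ∫ x, ∫ y, f y ∂(κ x) ∂μ := by
  rw [Measure.comp_eq_comp_const_apply] at hf ⊢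
  rw [Kernel.integral_comp hf, Kernel.const_apply]

theorem integrable_integral_bind_kernel {X Y : Type*} [MeasurableSpace X] [MeasurableSpace Y]
    {μ : Measure X} {κ : Kernel X Y} {f : Y → ℝ} (hf : Integrable f (μ.bind κ)) :
    Integrable (fun x => ∫ y, f y ∂(κ x)) μ := by
  rw [Measure.comp_eq_comp_const_apply] at hf
  simpa using hf.integral_comp

end Measure

namespace LQProblem

variable {n m k N : ℕ} (S : LQProblem n m k N)

/-- The law of `x_t`. -/
noncomputable def stateLaw (π : ControlPolicy n m) (γ : OpponentPolicy n k) (x : Fin n → ℝ) (t : ℕ) :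
    Measure (Fin n → ℝ) :=
  (S.law π γ x).map fun ω => ω t

variable (π : ControlPolicy n m) (γ : OpponentPolicy n k) (x : Fin n → ℝ)

instance : IsProbabilityMeasure (S.law π γ x) := by
  unfold law
  infer_instance

instance (t : ℕ) : IsProbabilityMeasure (S.stateLaw π γ x t) :=
  Measure.isProbabilityMeasure_map (measurable_pi_apply t).aemeasurable

theorem stateLaw_zero : S.stateLaw π γ x 0 = Measure.dirac x := by
  have h := Kernel.traj_map_frestrictLe_apply (X := fun _ => Fin n → ℝ)
    (κ := S.pathKernel π γ) 0 0 (fun _ => x)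
  rw [Kernel.partialTraj_self, Kernel.id_apply] at h
  have h2 := congrArg (Measure.map fun y : (Finset.Iic 0 → (Fin n → ℝ)) =>
    y ⟨0, Finset.mem_Iic.2 le_rfl⟩) h
  rw [Measure.map_map (measurable_pi_apply _) (by fun_prop)] at h2
  exact h2.trans (Measure.map_dirac' (measurable_pi_apply _) _)

/-- The path kernel depends only on the last coordinate of the past, so the marginals evolve as
those of a Markov chain. -/
theorem stateLaw_succ (t : ℕ) :
    S.stateLaw π γ x (t + 1) = (S.stateLaw π γ x t).bind (S.stepKernel π γ t) := by
  have h1 : S.stateLaw π γ x (t + 1) =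
      (S.law π γ x |>.map (Preorder.frestrictLe t)).bind (S.pathKernel π γ t) := by
    rw [stateLaw, law, Kernel.traj_map_frestrictLe_apply,
      ← Kernel.traj_comp_partialTraj (Nat.zero_le t), ← Kernel.map_apply _ (measurable_pi_apply _),
      Kernel.map_comp, Kernel.map_traj_succ_self, Kernel.comp_apply]
  rw [h1]
  ext s hs
  rw [Measure.bind_apply hs (Kernel.aemeasurable _), Measure.bind_apply hs (Kernel.aemeasurable _),
    stateLaw, lintegral_map (Kernel.measurable_coe _ hs) (by fun_prop),
    lintegral_map (Kernel.measurable_coe _ hs) (measurable_pi_apply t)]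
  rfl

theorem stepKernel_apply (t : ℕ) (y : Fin n → ℝ) :
    S.stepKernel π γ t y = (γ.dist t y).map fun w => S.next y (π.act t y) w := by
  have hm := S.measurable_next π t
  rw [stepKernel, Kernel.map_apply _ hm, Kernel.prod_apply, Kernel.id_apply, Measure.dirac_prod,
    Measure.map_map hm (by fun_prop)]
  rfl

theorem measurable_next_right (y : Fin n → ℝ) (u : Fin m → ℝ) :
    Measurable fun w => S.next y u w :=
  ((continuous_const.add (Continuous.matrix_mulVec continuous_const continuous_id))).measurable

theorem lintegral_stepKernel (t : ℕ) (y : Fin n → ℝ) {f : (Fin n → ℝ) → ℝ≥0∞} (hf : Measurable f) :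
    ∫⁻ z, f z ∂(S.stepKernel π γ t y) = ∫⁻ w, f (S.next y (π.act t y) w) ∂(γ.dist t y) := by
  rw [stepKernel_apply, lintegral_map hf (S.measurable_next_right y _)]

theorem integral_stepKernel (t : ℕ) (y : Fin n → ℝ) {f : (Fin n → ℝ) → ℝ} (hf : Measurable f) :
    ∫ z, f z ∂(S.stepKernel π γ t y) = ∫ w, f (S.next y (π.act t y) w) ∂(γ.dist t y) := by
  rw [stepKernel_apply, integral_map (S.measurable_next_right y _).aemeasurable
    hf.aestronglyMeasurable]

theorem lintegral_stateLaw_succ (t : ℕ) {f : (Fin n → ℝ) → ℝ≥0∞} (hf : Measurable f) :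
    ∫⁻ z, f z ∂(S.stateLaw π γ x (t + 1)) =
      ∫⁻ y, ∫⁻ w, f (S.next y (π.act t y) w) ∂(γ.dist t y) ∂(S.stateLaw π γ x t) := by
  rw [stateLaw_succ, Measure.lintegral_bind (Kernel.aemeasurable _) hf.aemeasurable]
  simp only [S.lintegral_stepKernel π γ t _ hf]

theorem integral_stateLaw_succ (t : ℕ) {f : (Fin n → ℝ) → ℝ} (hf : Measurable f)
    (hint : Integrable f (S.stateLaw π γ x (t + 1))) :
    ∫ z, f z ∂(S.stateLaw π γ x (t + 1)) =
      ∫ y, ∫ w, f (S.next y (π.act t y) w) ∂(γ.dist t y) ∂(S.stateLaw π γ x t) := by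
  rw [stateLaw_succ] at hint ⊢
  rw [integral_bind_kernel hint]
  simp only [S.integral_stepKernel π γ t _ hf]

theorem integrable_integral_stateLaw (t : ℕ) {f : (Fin n → ℝ) → ℝ} (hf : Measurable f)
    (hint : Integrable f (S.stateLaw π γ x (t + 1))) :
    Integrable (fun y => ∫ w, f (S.next y (π.act t y) w) ∂(γ.dist t y)) (S.stateLaw π γ x t) := by
  rw [stateLaw_succ] at hint
  simpa only [S.integral_stepKernel π γ t _ hf] using integrable_integral_bind_kernel hint

theorem integrable_law (t : ℕ) {f : (Fin n → ℝ) → ℝ}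
    (hint : Integrable f (S.stateLaw π γ x t)) :
    Integrable (fun ω => f (ω t)) (S.law π γ x) :=
  hint.comp_measurable (measurable_pi_apply t)

theorem integral_law (t : ℕ) {f : (Fin n → ℝ) → ℝ} (hf : Measurable f) :
    ∫ ω, f (ω t) ∂(S.law π γ x) = ∫ y, f y ∂(S.stateLaw π γ x t) :=
  (integral_map (measurable_pi_apply t).aemeasurable hf.aestronglyMeasurable).symm

/-- The cost of one stage. -/
noncomputable def stageCost (t : ℕ) (y : Fin n → ℝ) : ℝ :=
  y ⬝ᵥ S.Q *ᵥ y + π.act t y ⬝ᵥ S.R *ᵥ π.act t y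

theorem measurable_quad {ι : Type*} [Fintype ι] (W : Matrix ι ι ℝ) :
    Measurable fun y : ι → ℝ => y ⬝ᵥ W *ᵥ y :=
  (continuous_id.dotProduct (Continuous.matrix_mulVec continuous_const continuous_id)).measurable

theorem measurable_stageCost (t : ℕ) : Measurable (S.stageCost π t) :=
  (measurable_quad S.Q).add ((measurable_quad S.R).comp (π.measurable_act t))

theorem continuous_value (P : Matrix (Fin n) (Fin n) ℝ) (r : Fin n → ℝ) :
    Continuous (value P r) :=
  (continuous_id.dotProduct (Continuous.matrix_mulVec continuous_const continuous_id)).add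
    (continuous_const.mul (continuous_const.dotProduct continuous_id))

theorem runCost_eq (T : ℕ) :
    S.runCost π T = fun ω => ∑ t ∈ Finset.range T, S.stageCost π t (ω t) := rfl

theorem integrable_runCost {T : ℕ}
    (h : ∀ t < T, Integrable (S.stageCost π t) (S.stateLaw π γ x t)) :
    Integrable (S.runCost π T) (S.law π γ x) := by
  rw [runCost_eq]
  exact integrable_finsetSum _ fun t ht => S.integrable_law π γ x t (h t (Finset.mem_range.1 ht))

theorem integral_runCost {T : ℕ}
    (h : ∀ t < T, Integrable (S.stageCost π t) (S.stateLaw π γ x t)) :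
    ∫ ω, S.runCost π T ω ∂(S.law π γ x) =
      ∑ t ∈ Finset.range T, ∫ y, S.stageCost π t y ∂(S.stateLaw π γ x t) := by
  rw [runCost_eq]
  have h1 := integral_finsetSum (μ := S.law π γ x) (Finset.range T)
    (f := fun t ω => S.stageCost π t (ω t))
    fun t ht => S.integrable_law π γ x t (h t (Finset.mem_range.1 ht))
  refine h1.trans (Finset.sum_congr rfl fun t _ => ?_)
  exact S.integral_law π γ x t (S.measurable_stageCost π t)

/-! ### The empirical distribution -/

theorem lintegral_ν (f : (Fin k → ℝ) → ℝ≥0∞) :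
    ∫⁻ v, f v ∂S.ν = (N : ℝ≥0∞)⁻¹ * ∑ i, f (S.sample i) := by
  simp [ν, lintegral_smul_measure, lintegral_finsetSum_measure]

theorem integrable_ν (hN : 0 < N) (f : (Fin k → ℝ) → ℝ) : Integrable f S.ν := by
  refine Integrable.smul_measure ?_ (by simp [hN.ne'])
  exact integrable_finsetSum_measure.2 fun i _ => integrable_dirac (by simp)

theorem integral_ν (f : (Fin k → ℝ) → ℝ) :
    ∫ v, f v ∂S.ν = (N : ℝ)⁻¹ * ∑ i, f (S.sample i) := by
  rw [ν, integral_smul_measure, integral_finsetSum_measure fun i _ => integrable_dirac (by simp)]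
  simp

theorem ae_ν : ∀ᵐ v ∂S.ν, ∃ i, v = S.sample i := by
  refine Measure.ae_smul_measure ?_ _
  rw [ae_finsetSum_measure_iff]
  intro i _
  rw [ae_dirac_eq]
  exact ⟨i, rfl⟩

end LQProblem

theorem enorm_toLp_sq {k : ℕ} (v : Fin k → ℝ) :
    ‖WithLp.toLp 2 v‖ₑ ^ 2 = ENNReal.ofReal (v ⬝ᵥ v) := by
  rw [← ofReal_norm, ← ENNReal.ofReal_pow (norm_nonneg _), EuclideanSpace.real_norm_sq_eq]
  congr 1
  simp [dotProduct, sq]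

theorem dotProduct_self_nonneg {ι : Type*} [Fintype ι] (v : ι → ℝ) : 0 ≤ v ⬝ᵥ v :=
  Finset.sum_nonneg fun i _ => mul_self_nonneg (v i)

/-- A coupling that is close to optimal. -/
theorem exists_coupling_of_W2_le {k : ℕ} {μ ν : Measure (Fin k → ℝ)} {θ ε : ℝ} (hθ : 0 ≤ θ)
    (hε : 0 < ε) (h : W2 μ ν ≤ ENNReal.ofReal θ) :
    ∃ η : Measure ((Fin k → ℝ) × (Fin k → ℝ)), η.fst = μ ∧ η.snd = ν ∧
      ∫⁻ z, ENNReal.ofReal ((z.1 - z.2) ⬝ᵥ (z.1 - z.2)) ∂η ≤ ENNReal.ofReal ((θ + ε) ^ 2) := by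
  have h1 : W2 μ ν < ENNReal.ofReal (θ + ε) :=
    h.trans_lt ((ENNReal.ofReal_lt_ofReal_iff (by linarith)).2 (by linarith))
  simp only [W2, iInf_lt_iff, Set.mem_ofPred_eq, enorm_toLp_sq] at h1
  obtain ⟨η, ⟨h2, h3⟩, h4⟩ := h1
  refine ⟨η, h2, h3, ?_⟩
  have h5 := ENNReal.rpow_le_rpow h4.le (zero_le_two (α := ℝ))
  rw [← ENNReal.rpow_mul, one_div_mul_cancel two_ne_zero, ENNReal.rpow_one,
    ENNReal.rpow_ofNat] at h5
  rwa [← ENNReal.ofReal_pow (by linarith)] at h5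

theorem W2_sq_le {k : ℕ} {μ ν : Measure (Fin k → ℝ)}
    (η : Measure ((Fin k → ℝ) × (Fin k → ℝ))) (h1 : η.fst = μ) (h2 : η.snd = ν) :
    W2 μ ν ^ 2 ≤ ∫⁻ z, ENNReal.ofReal ((z.1 - z.2) ⬝ᵥ (z.1 - z.2)) ∂η := by
  have h : W2 μ ν ≤ (∫⁻ z, ENNReal.ofReal ((z.1 - z.2) ⬝ᵥ (z.1 - z.2)) ∂η) ^ (1 / 2 : ℝ) := by
    simp only [W2, enorm_toLp_sq]
    exact iInf₂_le η ⟨h1, h2⟩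
  refine (pow_le_pow_left₀ zero_le h 2).trans_eq ?_
  rw [← ENNReal.rpow_natCast, ← ENNReal.rpow_mul]
  norm_num

/-! ### Opponents with finitely supported disturbances -/

section Mixture

variable {N : ℕ} {X Y : Type*} [MeasurableSpace X] [MeasurableSpace Y]

/-- The kernel that selects one of the points `f i x` uniformly at random. -/
noncomputable def mixKernel (f : Fin N → X → Y) (hf : ∀ i, Measurable (f i)) : Kernel X Y where
  toFun x := (N : ℝ≥0∞)⁻¹ • ∑ i, Measure.dirac (f i x)
  measurable' := by
    refine Measure.measurable_of_measurable_coe _ fun s hs => ?_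
    simp only [Measure.smul_apply, Measure.coe_finsetSum, Finset.sum_apply, smul_eq_mul]
    exact (Finset.measurable_sum _ fun i _ =>
      (Measure.measurable_coe hs).comp (Measure.measurable_dirac.comp (hf i))).const_mul _

variable (f : Fin N → X → Y) (hf : ∀ i, Measurable (f i))

theorem isMarkovKernel_mixKernel (hN : 0 < N) : IsMarkovKernel (mixKernel f hf) := by
  refine ⟨fun x => ⟨?_⟩⟩
  simp only [mixKernel, Kernel.coe_mk, Measure.smul_apply, Measure.coe_finsetSum,
    Finset.sum_apply, measure_univ, Finset.sum_const, Finset.card_univ, Fintype.card_fin,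
    nsmul_eq_mul, mul_one, smul_eq_mul]
  exact ENNReal.inv_mul_cancel (by simp [hN.ne']) (by simp)

theorem lintegral_mixKernel (x : X) {g : Y → ℝ≥0∞} (hg : Measurable g) :
    ∫⁻ y, g y ∂(mixKernel f hf x) = (N : ℝ≥0∞)⁻¹ * ∑ i, g (f i x) := by
  simp [mixKernel, lintegral_smul_measure, lintegral_finsetSum_measure, lintegral_dirac' _ hg]

theorem integral_mixKernel [MeasurableSingletonClass Y] (x : X) (g : Y → ℝ) :
    ∫ y, g y ∂(mixKernel f hf x) = (N : ℝ)⁻¹ * ∑ i, g (f i x) := by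
  simp only [mixKernel, Kernel.coe_mk]
  rw [integral_smul_measure, integral_finsetSum_measure fun i _ => integrable_dirac (by simp)]
  simp

end Mixture

/-- The opponent policy that selects one of the points `f t i x` uniformly at random. -/
noncomputable def mixPolicy {n k N : ℕ} (hN : 0 < N) (f : ℕ → Fin N → (Fin n → ℝ) → (Fin k → ℝ))
    (hf : ∀ t i, Measurable (f t i)) : OpponentPolicy n k where
  dist t := mixKernel (f t) (hf t)
  markov_dist _ := isMarkovKernel_mixKernel _ _ hN

namespace LQProblem

variable {n m k N : ℕ} (S : LQProblem n m k N)

section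

variable (hN : 0 < N) (f : ℕ → Fin N → (Fin n → ℝ) → (Fin k → ℝ))
  (hf : ∀ t i, Measurable (f t i)) (π : ControlPolicy n m) (x : Fin n → ℝ)

/-- From a fixed start each step branches into at most N points, so every x_t has finite support. No
growth condition on the control policy is needed. -/
theorem lintegral_mixPolicy_lt_top (t : ℕ) {g : (Fin n → ℝ) → ℝ≥0∞} (hg : Measurable g)
    (hfin : ∀ y, g y < ∞) : ∫⁻ y, g y ∂(S.stateLaw π (mixPolicy hN f hf) x t) < ∞ := by
  induction t generalizing g with
  | zero => rw [stateLaw_zero, lintegral_dirac' _ hg]; exact hfin x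
  | succ t ih =>
    have h1 : ∀ y, ∫⁻ w, g (S.next y (π.act t y) w) ∂((mixPolicy hN f hf).dist t y) =
        (N : ℝ≥0∞)⁻¹ * ∑ i, g (S.next y (π.act t y) (f t i y)) := fun y =>
      lintegral_mixKernel (f t) (hf t) y (hg.comp (S.measurable_next_right y _))
    rw [S.lintegral_stateLaw_succ π _ x t hg]
    simp only [h1]
    refine ih ?_ fun y => ENNReal.mul_lt_top (by simp [hN]) (ENNReal.sum_lt_top.2 fun i _ => hfin _)
    exact (Finset.measurable_sum _ fun i _ => hg.comp
      ((S.measurable_next π t).comp (measurable_id.prodMk (hf t i)))).const_mul _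

theorem integrable_mixPolicy (t : ℕ) {g : (Fin n → ℝ) → ℝ} (hg : Measurable g) :
    Integrable g (S.stateLaw π (mixPolicy hN f hf) x t) :=
  ⟨hg.aestronglyMeasurable, S.lintegral_mixPolicy_lt_top hN f hf π x t hg.enorm
    fun _ => enorm_lt_top⟩

/-- The coupling that pairs the i-th atom with the i-th sample point. -/
theorem W2_mixPolicy_sq_le (t : ℕ) (y : Fin n → ℝ) :
    W2 ((mixPolicy hN f hf).dist t y) S.ν ^ 2 ≤ ENNReal.ofReal
      ((N : ℝ)⁻¹ * ∑ i, (f t i y - S.sample i) ⬝ᵥ (f t i y - S.sample i)) := by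
  refine (W2_sq_le ((N : ℝ≥0∞)⁻¹ • ∑ i, Measure.dirac (f t i y, S.sample i)) ?_ ?_).trans_eq ?_
  · simp only [Measure.fst, Measure.map_smul, mixPolicy, mixKernel, Kernel.coe_mk]
    rw [Measure.map_finset_sum' measurable_fst.aemeasurable]
    simp [Measure.map_dirac' measurable_fst]
  · simp only [Measure.snd, Measure.map_smul, ν]
    rw [Measure.map_finset_sum' measurable_snd.aemeasurable]
    simp [Measure.map_dirac' measurable_snd]
  · rw [lintegral_smul_measure, lintegral_finsetSum_measure, ENNReal.ofReal_mul (by positivity),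
      ENNReal.ofReal_inv_of_pos (by positivity), ENNReal.ofReal_natCast,
      ENNReal.ofReal_sum_of_nonneg fun i _ => dotProduct_self_nonneg _]
    simp

end

/-! ### The lower bound for the value of the finite-horizon game -/

variable {lam : ℝ} {P : Matrix (Fin n) (Fin n) ℝ}

theorem measurable_disturbance (P : Matrix (Fin n) (Fin n) ℝ) (r : Fin n → ℝ) (d : Fin k → ℝ) :
    Measurable (S.disturbance lam P r d) := by
  have hc : Continuous fun x : Fin n → ℝ => S.costate lam P r x :=
    Continuous.matrix_mulVec continuous_const ((Continuous.matrix_mulVec continuous_const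
      ((Continuous.matrix_mulVec continuous_const continuous_id).add continuous_const)).add
        continuous_const)
  exact ((continuous_const.add
    ((Continuous.matrix_mulVec continuous_const hc).const_smul lam⁻¹)).add
      continuous_const).measurable

/-- The growth of the value of the game with `s` stages to go when one more stage is added. -/
noncomputable def stageGrowth (lam : ℝ) (δ : Fin N → Fin k → ℝ) (s : ℕ) : ℝ :=
  S.stageConst lam (S.riccatiZero lam s) (S.linearZero lam s)
    + (N : ℝ)⁻¹ * ∑ i, S.deviationGain lam (S.riccatiZero lam s) (δ i) (S.sample i)

/-- The value function with `s` stages to go, up to constants. -/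
noncomputable def valueZero (lam : ℝ) (s : ℕ) : (Fin n → ℝ) → ℝ :=
  value (S.riccatiZero lam s) (S.linearZero lam s)

/-- Verification by dynamic programming: against saddle disturbances the value with s stages to go
is a subsolution along every control, and telescoping gives the bound. The terminal cost is
discarded as nonnegative. -/
theorem exists_le_finiteCost (hN : 0 < N) (hQ : S.Q.PosSemidef) (hQf : S.Qf.PosSemidef)
    (hR : S.R.PosDef) (hlam : 0 < lam) (hΦ : (S.Φ lam).PosSemidef) (π : ControlPolicy n m)
    (x : Fin n → ℝ) (T : ℕ) {δ : Fin N → Fin k → ℝ} (hδ : ∑ i, δ i = 0) :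
    ∃ γ, (((T : ℝ)⁻¹ * (S.valueZero lam T x + ∑ s ∈ Finset.range T, S.stageGrowth lam δ s) : ℝ)
      : EReal) ≤ S.finiteCost lam T π γ x := by
  -- `T - 1 - t` is the number of stages left after stage `t`, which indexes the cost-to-go of the
  -- successor.
  set f : ℕ → Fin N → (Fin n → ℝ) → (Fin k → ℝ) := fun t i =>
    S.disturbance lam (S.riccatiZero lam (T - 1 - t)) (S.linearZero lam (T - 1 - t)) (δ i) with hfdef
  have hf : ∀ t i, Measurable (f t i) := fun t i => S.measurable_disturbance _ _ _
  set γ := mixPolicy hN f hf with hγ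
  refine ⟨γ, ?_⟩
  set pen : ℕ → (Fin n → ℝ) → ℝ := fun t y =>
    (N : ℝ)⁻¹ * ∑ i, (f t i y - S.sample i) ⬝ᵥ (f t i y - S.sample i) with hpen
  have hpen0 : ∀ t y, 0 ≤ pen t y := fun t y =>
    mul_nonneg (by positivity) (Finset.sum_nonneg fun i _ => dotProduct_self_nonneg _)
  have hpenm : ∀ t, Measurable (pen t) := fun t => by
    refine (Finset.measurable_sum _ fun i _ => ?_).const_mul _
    have : Measurable fun v : Fin k → ℝ => (v - S.sample i) ⬝ᵥ (v - S.sample i) :=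
      ((continuous_id.sub continuous_const).dotProduct
        (continuous_id.sub continuous_const)).measurable
    exact this.comp (hf t i)
  have hint : ∀ t {g : (Fin n → ℝ) → ℝ}, Measurable g → Integrable g (S.stateLaw π γ x t) :=
    fun t g hg => S.integrable_mixPolicy hN f hf π x t hg
  have hVm : ∀ s, Measurable (S.valueZero lam s) := fun s => (continuous_value _ _).measurable
  have hstage : ∀ t < T, ∀ y, S.valueZero lam (T - t) y + S.stageGrowth lam δ (T - 1 - t) ≤
      (S.stageCost π t y - lam * pen t y)
        + ∫ w, S.valueZero lam (T - 1 - t) (S.next y (π.act t y) w) ∂(γ.dist t y) := by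
    intro t ht y
    have h := S.le_stage_average hN hΦ (S.posSemidef_riccatiZero hQ hΦ (T - 1 - t)) hR hlam
      (S.linearZero lam (T - 1 - t)) y (π.act t y) hδ
    have hs : T - t = (T - 1 - t) + 1 := by omega
    rw [hs]
    refine h.trans_eq ?_
    congr 1
    exact (integral_mixKernel (f t) (hf t) y
      fun w => S.valueZero lam (T - 1 - t) (S.next y (π.act t y) w)).symm
  have htel : ∀ j ≤ T, S.valueZero lam T x + ∑ t ∈ Finset.range j, S.stageGrowth lam δ (T - 1 - t) ≤
      ∑ t ∈ Finset.range j, ∫ y, (S.stageCost π t y - lam * pen t y) ∂(S.stateLaw π γ x t)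
        + ∫ y, S.valueZero lam (T - j) y ∂(S.stateLaw π γ x j) := by
    intro j
    induction j with
    | zero =>
      intro _
      rw [stateLaw_zero, integral_dirac]
      simp
    | succ j ih =>
      intro hj
      have hm : Measurable fun y => S.stageCost π j y - lam * pen j y :=
        (S.measurable_stageCost π j).sub ((hpenm j).const_mul lam)
      have hV' := hint (j + 1) (hVm (T - 1 - j))
      have h1 : ∫ y, (S.valueZero lam (T - j) y + S.stageGrowth lam δ (T - 1 - j))
          ∂(S.stateLaw π γ x j) ≤ ∫ y, ((S.stageCost π j y - lam * pen j y)
            + ∫ w, S.valueZero lam (T - 1 - j) (S.next y (π.act j y) w) ∂(γ.dist j y))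
          ∂(S.stateLaw π γ x j) :=
        integral_mono ((hint j (hVm _)).add (integrable_const _))
          ((hint j hm).add (S.integrable_integral_stateLaw π γ x j (hVm _) hV'))
          (hstage j (by omega))
      rw [integral_add (hint j (hVm _)) (integrable_const _), integral_add (hint j hm)
        (S.integrable_integral_stateLaw π γ x j (hVm _) hV'), integral_const, probReal_univ,
        one_smul, ← S.integral_stateLaw_succ π γ x j (hVm _) hV'] at h1
      rw [Finset.sum_range_succ, Finset.sum_range_succ, show T - (j + 1) = T - 1 - j by omega]
      have := ih (by omega)
      linarith
  have hfinal := htel T le_rfl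
  -- Time to go runs backwards, and at time `T` the value with 0 stages to go vanishes.
  rw [Finset.sum_range_reflect (S.stageGrowth lam δ) T, Nat.sub_self] at hfinal
  have hzero : ∀ y, S.valueZero lam 0 y = 0 := fun y => by
    simp [valueZero, value, riccatiZero, linearZero]
  simp only [hzero, integral_zero, add_zero] at hfinal
  have hintcost : ∀ t, Integrable (fun ω : ℕ → Fin n → ℝ => S.stageCost π t (ω t))
      (S.law π γ x) := fun t => S.integrable_law π γ x t (hint t (S.measurable_stageCost π t))
  set g : (ℕ → (Fin n → ℝ)) → ℝ := fun ω => ω T ⬝ᵥ S.Qf *ᵥ ω T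
    + ∑ t ∈ Finset.range T, (S.stageCost π t (ω t) - lam * pen t (ω t)) with hg
  have hm : ∀ t, Measurable fun y => S.stageCost π t y - lam * pen t y := fun t =>
    (S.measurable_stageCost π t).sub ((hpenm t).const_mul lam)
  have hgT := S.integrable_law π γ x T (hint T (measurable_quad S.Qf))
  have hgs := fun t => S.integrable_law π γ x t (hint t (hm t))
  have hgint : Integrable g (S.law π γ x) :=
    hgT.add (integrable_finsetSum _ fun t _ => hgs t)
  have hgval : S.valueZero lam T x + ∑ s ∈ Finset.range T, S.stageGrowth lam δ s ≤
      ∫ ω, g ω ∂(S.law π γ x) := by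
    have h1 : ∫ ω, g ω ∂(S.law π γ x) = ∫ y, y ⬝ᵥ S.Qf *ᵥ y ∂(S.stateLaw π γ x T)
        + ∑ t ∈ Finset.range T, ∫ y, (S.stageCost π t y - lam * pen t y) ∂(S.stateLaw π γ x t) := by
      rw [hg, integral_add hgT (integrable_finsetSum _ fun t _ => hgs t),
        integral_finsetSum _ fun t _ => hgs t, S.integral_law π γ x T (measurable_quad S.Qf)]
      congr 1
      exact Finset.sum_congr rfl fun t _ => S.integral_law π γ x t (hm t)
    rw [h1]
    exact hfinal.trans (le_add_of_nonneg_left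
      (integral_nonneg fun y => posSemidef_quad_nonneg hQf y))
  have hle : ∀ ω, ((g ω : ℝ) : EReal) ≤ ((ω T ⬝ᵥ S.Qf *ᵥ ω T + S.runCost π T ω : ℝ) : EReal)
      - ((ENNReal.ofReal lam * S.penalty γ T ω : ℝ≥0∞) : EReal) := by
    intro ω
    have h1 : ENNReal.ofReal lam * S.penalty γ T ω ≤
        ENNReal.ofReal (lam * ∑ t ∈ Finset.range T, pen t (ω t)) := by
      rw [ENNReal.ofReal_mul hlam.le, ENNReal.ofReal_sum_of_nonneg fun t _ => hpen0 t _]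
      gcongr
      exact Finset.sum_le_sum fun t _ => S.W2_mixPolicy_sq_le hN f hf t (ω t)
    have h2 : g ω = (ω T ⬝ᵥ S.Qf *ᵥ ω T + S.runCost π T ω)
        - lam * ∑ t ∈ Finset.range T, pen t (ω t) := by
      rw [hg, runCost_eq]
      simp only [Finset.sum_sub_distrib, ← Finset.mul_sum]
      ring
    rw [h2, EReal.coe_sub]
    refine EReal.sub_le_sub le_rfl ((EReal.coe_ennreal_le_coe_ennreal_iff.2 h1).trans_eq ?_)
    rw [EReal.coe_ennreal_ofReal, max_eq_left]
    exact mul_nonneg hlam.le (Finset.sum_nonneg fun t _ => hpen0 t _)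
  have hT : (0 : EReal) ≤ (((T : ℝ)⁻¹ : ℝ) : EReal) := by
    exact_mod_cast (by positivity : (0 : ℝ) ≤ (T : ℝ)⁻¹)
  rw [finiteCost, EReal.coe_mul]
  refine mul_le_mul_of_nonneg_left ?_ hT
  refine le_trans ?_ (eexp_mono hle)
  rw [eexp_coe hgint]
  exact_mod_cast hgval

theorem le_steadyCost_of_sum_eq_zero (hN : 0 < N) (hQ : S.Q.PosSemidef) (hQf : S.Qf.PosSemidef)
    (hR : S.R.PosDef) (hlam : 0 < lam) (hΦ : (S.Φ lam).PosSemidef)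
    (hobs : S.ObservabilityCondition) (hP : S.IsAREsolution lam P)
    (hlim : Tendsto (S.riccatiZero lam) atTop (nhds P)) (x : Fin n → ℝ)
    {δ : Fin N → Fin k → ℝ} (hδ : ∑ i, δ i = 0) :
    ((S.stageConst lam P (S.rss lam P)
      + (N : ℝ)⁻¹ * ∑ i, S.deviationGain lam P (δ i) (S.sample i) : ℝ) : EReal) ≤
      S.steadyCost lam x := by
  have hlin := S.tendsto_linearZero hQ hΦ hobs hP hlim
  have hgrow : Tendsto (S.stageGrowth lam δ) atTop (nhds (S.stageConst lam P (S.rss lam P)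
      + (N : ℝ)⁻¹ * ∑ i, S.deviationGain lam P (δ i) (S.sample i))) :=
    (S.tendsto_stageConst hΦ hP.1 hlim hlin).add
      ((tendsto_finsetSum _ fun i _ => S.tendsto_deviationGain hlim _ _).const_mul _)
  have hval : Tendsto (fun T : ℕ => S.valueZero lam T x) atTop
      (nhds (value P (S.rss lam P) x)) :=
    (tendsto_dotProduct tendsto_const_nhds (tendsto_mulVec hlim tendsto_const_nhds)).add
      ((tendsto_dotProduct hlin tendsto_const_nhds).const_mul 2)
  have h0 : Tendsto (fun T : ℕ => (T : ℝ)⁻¹ * S.valueZero lam T x) atTop (nhds 0) := by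
    simpa using tendsto_inv_atTop_nhds_zero_nat.mul hval
  have hlimit := h0.add hgrow.cesaro
  rw [zero_add] at hlimit
  have hlimit' := (continuous_coe_real_ereal.tendsto _).comp hlimit
  rw [← hlimit'.limsup_eq]
  refine limsup_le_limsup (Eventually.of_forall fun T => le_iInf fun π => ?_)
  obtain ⟨γ, hγ⟩ := S.exists_le_finiteCost hN hQ hQf hR hlam hΦ π x T hδ
  rw [mul_add] at hγ
  exact hγ.trans (le_iSup (fun γ => S.finiteCost lam T π γ x) γ)

/-- Under a common shift a the linear terms cancel in the sum, because deviations and centred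
samples both sum to zero. What remains is N times (Ξa)ᵀP(Ξa) - λ|a|², which is nonpositive. -/
theorem sum_deviationGain_le (hN : 0 < N) (hP : P.PosSemidef)
    (hle : ∀ v, S.Ξ *ᵥ v ⬝ᵥ P *ᵥ (S.Ξ *ᵥ v) ≤ lam * (v ⬝ᵥ v)) {δ : Fin N → Fin k → ℝ}
    (hδ : ∑ i, δ i = 0) (a : Fin k → ℝ) :
    ∑ i, S.deviationGain lam P (δ i + a) (S.sample i) ≤
      ∑ i, S.deviationGain lam P (δ i) (S.sample i) := by
  have h1 : ∀ i, S.deviationGain lam P (δ i + a) (S.sample i) =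
      S.deviationGain lam P (δ i) (S.sample i)
        + 2 * (P *ᵥ (S.Ξ *ᵥ a) ⬝ᵥ S.Ξ *ᵥ δ i - lam * (a ⬝ᵥ δ i)
          + lam * (a ⬝ᵥ (S.sample i - S.wbar)))
        + (S.Ξ *ᵥ a ⬝ᵥ P *ᵥ (S.Ξ *ᵥ a) - lam * (a ⬝ᵥ a)) := fun i => by
    have h2 : δ i + a - (S.sample i - S.wbar) = a + (δ i - (S.sample i - S.wbar)) := by abel
    have h3 : a ⬝ᵥ (δ i - (S.sample i - S.wbar)) = a ⬝ᵥ δ i - a ⬝ᵥ (S.sample i - S.wbar) :=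
      dotProduct_sub _ _ _
    have h4 := dotProduct_comm (δ i - (S.sample i - S.wbar)) a
    rw [deviationGain, deviationGain, h2, add_comm (δ i) a, Matrix.mulVec_add,
      quad_add (posSemidef_transpose hP), add_dotProduct, dotProduct_add, dotProduct_add, h4, h3]
    ring
  have h5 : ∑ i, P *ᵥ (S.Ξ *ᵥ a) ⬝ᵥ S.Ξ *ᵥ δ i = 0 := by
    rw [← dotProduct_sum, ← Matrix.mulVec_sum, hδ, Matrix.mulVec_zero, dotProduct_zero]
  have h6 : ∑ i, a ⬝ᵥ δ i = 0 := by rw [← dotProduct_sum, hδ, dotProduct_zero]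
  have h7 : ∑ i, a ⬝ᵥ (S.sample i - S.wbar) = 0 := by
    rw [← dotProduct_sum, S.sum_sample_sub_wbar hN, dotProduct_zero]
  calc ∑ i, S.deviationGain lam P (δ i + a) (S.sample i)
      ≤ ∑ i, (S.deviationGain lam P (δ i) (S.sample i)
        + 2 * (P *ᵥ (S.Ξ *ᵥ a) ⬝ᵥ S.Ξ *ᵥ δ i - lam * (a ⬝ᵥ δ i)
          + lam * (a ⬝ᵥ (S.sample i - S.wbar)))) :=
        Finset.sum_le_sum fun i _ => by
          rw [h1 i]
          exact add_le_of_nonpos_right (sub_nonpos.2 (hle a))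
    _ = _ := by
        rw [Finset.sum_add_distrib, ← Finset.mul_sum, Finset.sum_add_distrib,
          Finset.sum_sub_distrib, ← Finset.mul_sum, ← Finset.mul_sum, h5, h6, h7]
        ring

/-- Subtracting the mean of the deviations can only raise the total gain, so the sum-zero bound
holds for arbitrary deviations, which may then be optimized one by one. -/
theorem le_steadyCost (hN : 0 < N) (hQ : S.Q.PosSemidef) (hQf : S.Qf.PosSemidef)
    (hR : S.R.PosDef) (hlam : 0 < lam) (hΦ : (S.Φ lam).PosSemidef)
    (hobs : S.ObservabilityCondition) (hP : S.IsAREsolution lam P)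
    (hlim : Tendsto (S.riccatiZero lam) atTop (nhds P))
    (hle : ∀ v, S.Ξ *ᵥ v ⬝ᵥ P *ᵥ (S.Ξ *ᵥ v) ≤ lam * (v ⬝ᵥ v)) (x : Fin n → ℝ)
    (δ : Fin N → Fin k → ℝ) :
    ((S.stageConst lam P (S.rss lam P)
      + (N : ℝ)⁻¹ * ∑ i, S.deviationGain lam P (δ i) (S.sample i) : ℝ) : EReal) ≤
      S.steadyCost lam x := by
  set a : Fin k → ℝ := (N : ℝ)⁻¹ • ∑ i, δ i with ha
  have hN' : (N : ℝ) ≠ 0 := by positivity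
  have hδ : ∑ i, (δ i - a) = 0 := by
    rw [Finset.sum_sub_distrib, Finset.sum_const, Finset.card_univ, Fintype.card_fin,
      ← Nat.cast_smul_eq_nsmul ℝ, ha, smul_smul, mul_inv_cancel₀ hN', one_smul, sub_self]
  refine le_trans ?_ (S.le_steadyCost_of_sum_eq_zero hN hQ hQf hR hlam hΦ hobs hP hlim x hδ)
  have h := S.sum_deviationGain_le hN hP.1 hle hδ a
  simp only [sub_add_cancel] at h
  rw [EReal.coe_le_coe_iff]
  gcongr

end LQProblem

/-! ### The upper bound for the stationary policy -/

/-- Suprema over independent variables may be taken term by term. -/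
theorem sum_ciSup_le {N : ℕ} {D : Type*} [Nonempty D] {f : Fin N → D → ℝ}
    {C : ℝ} (h : ∀ δ : Fin N → D, ∑ i, f i (δ i) ≤ C) :
    (∀ i, BddAbove (Set.range (f i))) ∧ ∑ i, ⨆ d, f i d ≤ C := by
  classical
  obtain ⟨d₀⟩ := ‹Nonempty D›
  -- All other variables are frozen at `d₀`, so the joint bound becomes a bound on one summand.
  have hbdd : ∀ i, BddAbove (Set.range (f i)) := fun i => by
    refine ⟨C - ∑ j ∈ Finset.univ.erase i, f j d₀, ?_⟩
    rintro _ ⟨d, rfl⟩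
    have h1 := h (Function.update (fun _ => d₀) i d)
    rw [← Finset.add_sum_erase _ _ (Finset.mem_univ i), Function.update_self] at h1
    have h2 : ∑ j ∈ Finset.univ.erase i, f j (Function.update (fun _ => d₀) i d j)
        = ∑ j ∈ Finset.univ.erase i, f j d₀ :=
      Finset.sum_congr rfl fun j hj => by
        rw [Function.update_of_ne (Finset.ne_of_mem_erase hj)]
    linarith
  refine ⟨hbdd, le_of_forall_pos_le_add fun ε hε => ?_⟩
  -- Dividing by N + 1 keeps the slack positive when N = 0.
  have hlt : ∀ i, ∃ d, (⨆ d, f i d) - ε / (N + 1) < f i d := fun i =>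
    exists_lt_of_lt_ciSup (sub_lt_self _ (by positivity))
  choose δ hδ using hlt
  calc ∑ i, ⨆ d, f i d ≤ ∑ i, (f i (δ i) + ε / (N + 1)) :=
        Finset.sum_le_sum fun i _ => by linarith [hδ i]
    _ = ∑ i, f i (δ i) + N * (ε / (N + 1)) := by simp [Finset.sum_add_distrib]
    _ ≤ C + ε := by
        refine add_le_add (h δ) ?_
        rw [mul_div_assoc', div_le_iff₀ (by positivity)]
        nlinarith

theorem norm_sq_le_dotProduct {ι : Type*} [Fintype ι] (v : ι → ℝ) : ‖v‖ ^ 2 ≤ v ⬝ᵥ v := by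
  have h : ‖v‖ ≤ √(v ⬝ᵥ v) := (pi_norm_le_iff_of_nonneg (Real.sqrt_nonneg _)).2 fun i => by
    rw [Real.norm_eq_abs, ← Real.sqrt_sq_eq_abs]
    refine Real.sqrt_le_sqrt ?_
    rw [sq]
    exact Finset.single_le_sum (f := fun i => v i * v i) (fun i _ => mul_self_nonneg _)
      (Finset.mem_univ i)
  calc ‖v‖ ^ 2 ≤ √(v ⬝ᵥ v) ^ 2 := by gcongr
    _ = v ⬝ᵥ v := Real.sq_sqrt (dotProduct_self_nonneg v)

theorem measurable_dotProduct_self {ι : Type*} [Fintype ι] :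
    Measurable fun v : ι → ℝ => v ⬝ᵥ v :=
  (continuous_id.dotProduct continuous_id).measurable

namespace LQProblem

variable {n m k N : ℕ} (S : LQProblem n m k N) {lam θ : ℝ} {P : Matrix (Fin n) (Fin n) ℝ}

/-- The stationary policy is the saddle-point control; the explicit zero is the deviation `e` of
`stage_identity`. -/
theorem policySS_act (t : ℕ) (x : Fin n → ℝ) :
    (S.policySS lam P).act t x =
      0 - S.R⁻¹ *ᵥ (S.Bᵀ *ᵥ S.costate lam P (S.rss lam P) x) := by
  change S.Kss lam P *ᵥ x + S.Lss lam P = _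
  rw [Kss, Lss, costate, zero_sub, Matrix.neg_mulVec, ← neg_add, neg_inj]
  simp only [Matrix.mulVec_add, Matrix.mulVec_mulVec, Matrix.mul_assoc, add_assoc]

/-! ### Quadratic growth and integrability under the stationary policy -/

theorem exists_abs_value_le (P : Matrix (Fin n) (Fin n) ℝ) (r : Fin n → ℝ) :
    ∃ C, 0 ≤ C ∧ ∀ y, |value P r y| ≤ C * (1 + ‖y‖ ^ 2) := by
  obtain ⟨C, hC, h⟩ := exists_quad_le P
  refine ⟨C + n * ‖r‖, by positivity, fun y => ?_⟩
  have h1 := h y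
  have h2 := dotProduct_le_norm r y
  rw [Fintype.card_fin] at h2
  have h3 : 2 * ‖y‖ ≤ 1 + ‖y‖ ^ 2 := by nlinarith [sq_nonneg (‖y‖ - 1)]
  have h4 : (n * ‖r‖) * (2 * ‖y‖) ≤ (n * ‖r‖) * (1 + ‖y‖ ^ 2) := by gcongr
  calc |value P r y| ≤ |y ⬝ᵥ P *ᵥ y| + |2 * (r ⬝ᵥ y)| := abs_add_le _ _
    _ = |y ⬝ᵥ P *ᵥ y| + 2 * |r ⬝ᵥ y| := by rw [abs_mul, abs_two]
    _ ≤ _ := by nlinarith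

theorem exists_norm_act_sq_le (lam : ℝ) (P : Matrix (Fin n) (Fin n) ℝ) :
    ∃ C, 0 ≤ C ∧ ∀ t y, ‖(S.policySS lam P).act t y‖ ^ 2 ≤ C * (1 + ‖y‖ ^ 2) := by
  obtain ⟨C, hC, h⟩ := exists_norm_mulVec_le (S.Kss lam P)
  refine ⟨2 * C ^ 2 + 2 * ‖S.Lss lam P‖ ^ 2, by positivity, fun t y => ?_⟩
  have h1 : ‖(S.policySS lam P).act t y‖ ≤ C * ‖y‖ + ‖S.Lss lam P‖ :=
    (norm_add_le _ _).trans (by gcongr; exact h y)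
  calc ‖(S.policySS lam P).act t y‖ ^ 2 ≤ (C * ‖y‖ + ‖S.Lss lam P‖) ^ 2 := by gcongr
    _ ≤ 2 * (C * ‖y‖) ^ 2 + 2 * ‖S.Lss lam P‖ ^ 2 := by
        nlinarith [sq_nonneg (C * ‖y‖ - ‖S.Lss lam P‖)]
    _ ≤ _ := by nlinarith [sq_nonneg C, mul_nonneg (sq_nonneg ‖S.Lss lam P‖) (sq_nonneg ‖y‖)]

theorem exists_abs_stageCost_le (lam : ℝ) (P : Matrix (Fin n) (Fin n) ℝ) :
    ∃ C, 0 ≤ C ∧ ∀ t y, |S.stageCost (S.policySS lam P) t y| ≤ C * (1 + ‖y‖ ^ 2) := by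
  obtain ⟨C₁, hC₁, h₁⟩ := exists_quad_le S.Q
  obtain ⟨C₂, hC₂, h₂⟩ := exists_quad_le S.R
  obtain ⟨C₃, hC₃, h₃⟩ := S.exists_norm_act_sq_le lam P
  refine ⟨C₁ + C₂ * C₃, by positivity, fun t y => (abs_add_le _ _).trans ?_⟩
  have h4 := mul_le_mul_of_nonneg_left (h₃ t y) hC₂
  nlinarith [h₁ y, h₂ ((S.policySS lam P).act t y)]

theorem exists_norm_next_sq_le (lam : ℝ) (P : Matrix (Fin n) (Fin n) ℝ) :
    ∃ C, 0 ≤ C ∧ ∀ t y w, ‖S.next y ((S.policySS lam P).act t y) w‖ ^ 2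
      ≤ C * (1 + ‖y‖ ^ 2) + C * (w ⬝ᵥ w) := by
  obtain ⟨C₁, hC₁, h₁⟩ := exists_norm_mulVec_le S.A
  obtain ⟨C₂, hC₂, h₂⟩ := exists_norm_mulVec_le S.B
  obtain ⟨C₃, hC₃, h₃⟩ := exists_norm_mulVec_le S.Ξ
  obtain ⟨C₄, hC₄, h₄⟩ := S.exists_norm_act_sq_le lam P
  refine ⟨3 * (C₁ ^ 2 + C₂ ^ 2 * C₄ + C₃ ^ 2), by positivity, fun t y w => ?_⟩
  set u := (S.policySS lam P).act t y
  have h5 : ‖S.next y u w‖ ≤ C₁ * ‖y‖ + C₂ * ‖u‖ + C₃ * ‖w‖ := by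
    refine (norm_add₃_le).trans ?_
    gcongr
    exacts [h₁ y, h₂ u, h₃ w]
  have h6 : ‖S.next y u w‖ ^ 2 ≤ (C₁ * ‖y‖ + C₂ * ‖u‖ + C₃ * ‖w‖) ^ 2 := by gcongr
  have h7 : (C₁ * ‖y‖ + C₂ * ‖u‖ + C₃ * ‖w‖) ^ 2
      ≤ 3 * (C₁ ^ 2 * ‖y‖ ^ 2 + C₂ ^ 2 * ‖u‖ ^ 2 + C₃ ^ 2 * ‖w‖ ^ 2) := by
    nlinarith [sq_nonneg (C₁ * ‖y‖ - C₂ * ‖u‖), sq_nonneg (C₂ * ‖u‖ - C₃ * ‖w‖),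
      sq_nonneg (C₁ * ‖y‖ - C₃ * ‖w‖)]
  have h8 : C₂ ^ 2 * ‖u‖ ^ 2 ≤ C₂ ^ 2 * (C₄ * (1 + ‖y‖ ^ 2)) := by gcongr; exact h₄ t y
  have h9 : C₃ ^ 2 * ‖w‖ ^ 2 ≤ C₃ ^ 2 * (w ⬝ᵥ w) := by
    gcongr; exact norm_sq_le_dotProduct w
  have h10 := dotProduct_self_nonneg w
  have h11 : 0 ≤ C₁ ^ 2 := sq_nonneg _
  have h12 : 0 ≤ C₃ ^ 2 * (1 + ‖y‖ ^ 2) := by positivity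
  have h13 : 0 ≤ (C₁ ^ 2 + C₂ ^ 2 * C₄) * (w ⬝ᵥ w) := mul_nonneg (by positivity) h10
  nlinarith

/-- The second moments of the disturbances are bounded uniformly over the Wasserstein ball. -/
theorem exists_second_moment_le (hN : 0 < N) (hθ : 0 ≤ θ) :
    ∃ D : ℝ≥0∞, D < ∞ ∧ ∀ γ ∈ S.ballPolicies (n := n) θ, ∀ t y,
      ∫⁻ w, ENNReal.ofReal (w ⬝ᵥ w) ∂(γ.dist t y) ≤ D := by
  refine ⟨2 * ENNReal.ofReal ((θ + 1) ^ 2) + 2 * ∫⁻ v, ENNReal.ofReal (v ⬝ᵥ v) ∂S.ν, ?_, ?_⟩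
  · rw [lintegral_ν]
    refine ENNReal.add_lt_top.2 ⟨ENNReal.mul_lt_top (by simp) (by simp), ?_⟩
    exact ENNReal.mul_lt_top (by simp) (ENNReal.mul_lt_top (by simp [hN])
      (ENNReal.sum_lt_top.2 fun i _ => ENNReal.ofReal_lt_top))
  · intro γ hγ t y
    obtain ⟨η, h1, h2, h3⟩ := exists_coupling_of_W2_le hθ one_pos (hγ t y)
    have hm : Measurable fun v : Fin k → ℝ => ENNReal.ofReal (v ⬝ᵥ v) :=
      measurable_dotProduct_self.ennreal_ofReal
    rw [← h1, ← h2, Measure.fst, Measure.snd, lintegral_map hm measurable_fst,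
      lintegral_map hm measurable_snd]
    have hm1 : Measurable fun z : (Fin k → ℝ) × (Fin k → ℝ) =>
        2 * ENNReal.ofReal ((z.1 - z.2) ⬝ᵥ (z.1 - z.2)) :=
      (hm.comp (measurable_fst.sub measurable_snd)).const_mul 2
    calc ∫⁻ z, ENNReal.ofReal (z.1 ⬝ᵥ z.1) ∂η
        ≤ ∫⁻ z, (2 * ENNReal.ofReal ((z.1 - z.2) ⬝ᵥ (z.1 - z.2))
            + 2 * ENNReal.ofReal (z.2 ⬝ᵥ z.2)) ∂η := by
          refine lintegral_mono fun z => ?_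
          have h0 := dotProduct_self_nonneg (z.1 - z.2)
          have h0' := dotProduct_self_nonneg z.2
          rw [← ENNReal.ofReal_ofNat 2, ← ENNReal.ofReal_mul zero_le_two,
            ← ENNReal.ofReal_mul zero_le_two, ← ENNReal.ofReal_add (by linarith) (by linarith)]
          refine ENNReal.ofReal_le_ofReal ?_
          -- |w - 2v|² ≥ 0 rearranges to |w|² ≤ 2|w - v|² + 2|v|².
          have h4 := dotProduct_self_nonneg (z.1 - z.2 - z.2)
          simp only [sub_dotProduct, dotProduct_sub, dotProduct_comm z.2 z.1] at h4 ⊢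
          linarith
      _ = 2 * ∫⁻ z, ENNReal.ofReal ((z.1 - z.2) ⬝ᵥ (z.1 - z.2)) ∂η
            + 2 * ∫⁻ z, ENNReal.ofReal (z.2 ⬝ᵥ z.2) ∂η := by
          rw [lintegral_add_left hm1, lintegral_const_mul' _ _ ENNReal.ofNat_ne_top,
            lintegral_const_mul' _ _ ENNReal.ofNat_ne_top]
      _ ≤ _ := by gcongr

section Ball

variable (hN : 0 < N) (hθ : 0 ≤ θ) {γ : OpponentPolicy n k} (hγ : γ ∈ S.ballPolicies θ)
  (x : Fin n → ℝ)

include hN hθ hγ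

theorem integrable_disturbance_sq (t : ℕ) (y : Fin n → ℝ) :
    Integrable (fun w => w ⬝ᵥ w) (γ.dist t y) := by
  obtain ⟨D, hD, h⟩ := S.exists_second_moment_le (n := n) hN hθ
  refine ⟨measurable_dotProduct_self.aestronglyMeasurable, ?_⟩
  rw [hasFiniteIntegral_iff_ofReal (Eventually.of_forall dotProduct_self_nonneg)]
  exact (h γ hγ t y).trans_lt hD

theorem integrable_norm_sq (t : ℕ) :
    Integrable (fun y => ‖y‖ ^ 2) (S.stateLaw (S.policySS lam P) γ x t) := by
  obtain ⟨D, hD, hmom⟩ := S.exists_second_moment_le (n := n) hN hθ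
  obtain ⟨C, hC, hnext⟩ := S.exists_norm_next_sq_le lam P
  have hm : Measurable fun y : Fin n → ℝ => ‖y‖ ^ 2 := measurable_norm.pow_const 2
  induction t with
  | zero => rw [stateLaw_zero]; exact integrable_dirac (by simp)
  | succ t ih =>
    refine ⟨hm.aestronglyMeasurable, ?_⟩
    rw [hasFiniteIntegral_iff_ofReal (Eventually.of_forall fun y => by positivity),
      S.lintegral_stateLaw_succ _ γ x t hm.ennreal_ofReal]
    calc ∫⁻ y, ∫⁻ w, ENNReal.ofReal (‖S.next y ((S.policySS lam P).act t y) w‖ ^ 2) ∂(γ.dist t y)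
          ∂(S.stateLaw (S.policySS lam P) γ x t)
        ≤ ∫⁻ y, (ENNReal.ofReal (C * (1 + ‖y‖ ^ 2)) + ENNReal.ofReal C * D)
          ∂(S.stateLaw (S.policySS lam P) γ x t) := by
          refine lintegral_mono fun y => ?_
          calc ∫⁻ w, ENNReal.ofReal (‖S.next y ((S.policySS lam P).act t y) w‖ ^ 2) ∂(γ.dist t y)
              ≤ ∫⁻ w, (ENNReal.ofReal (C * (1 + ‖y‖ ^ 2))
                + ENNReal.ofReal C * ENNReal.ofReal (w ⬝ᵥ w)) ∂(γ.dist t y) := by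
                refine lintegral_mono fun w => ?_
                rw [← ENNReal.ofReal_mul hC, ← ENNReal.ofReal_add (by positivity)
                  (mul_nonneg hC (dotProduct_self_nonneg w))]
                exact ENNReal.ofReal_le_ofReal (hnext t y w)
            _ ≤ _ := by
                rw [lintegral_add_left measurable_const, lintegral_const, measure_univ, mul_one,
                  lintegral_const_mul _ measurable_dotProduct_self.ennreal_ofReal]
                gcongr
                exact hmom γ hγ t y
      _ < ∞ := by
          rw [lintegral_add_right _ measurable_const, lintegral_const, measure_univ, mul_one]
          refine ENNReal.add_lt_top.2 ⟨?_, ENNReal.mul_lt_top ENNReal.ofReal_lt_top hD⟩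
          have := ((integrable_const (1 : ℝ)).add ih).const_mul C
          exact (hasFiniteIntegral_iff_ofReal
            (Eventually.of_forall fun y =>
              mul_nonneg hC (add_nonneg zero_le_one (sq_nonneg _)))).1 this.2

theorem integrable_of_abs_le (t : ℕ) {f : (Fin n → ℝ) → ℝ} (hf : Measurable f) {C : ℝ}
    (h : ∀ y, |f y| ≤ C * (1 + ‖y‖ ^ 2)) :
    Integrable f (S.stateLaw (S.policySS lam P) γ x t) :=
  (((integrable_const (1 : ℝ)).add (S.integrable_norm_sq hN hθ hγ x t)).const_mul C).mono'
    hf.aestronglyMeasurable (Eventually.of_forall h)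

theorem integrable_stageCost (t : ℕ) :
    Integrable (S.stageCost (S.policySS lam P) t) (S.stateLaw (S.policySS lam P) γ x t) := by
  obtain ⟨C, _, h⟩ := S.exists_abs_stageCost_le lam P
  exact S.integrable_of_abs_le hN hθ hγ x t (S.measurable_stageCost _ t) (h t)

theorem integrable_value (t : ℕ) (r : Fin n → ℝ) :
    Integrable (value P r) (S.stateLaw (S.policySS lam P) γ x t) := by
  obtain ⟨C, _, h⟩ := exists_abs_value_le P r
  exact S.integrable_of_abs_le hN hθ hγ x t (continuous_value P r).measurable h

/-- One stage of the stationary policy against a disturbance in the Wasserstein ball. -/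
theorem integral_value_next_le (hΦ : (S.Φ lam).PosSemidef) (hP : S.IsAREsolution lam P)
    (hR : S.R.PosDef) (hlam : 0 < lam)
    (hr : S.linearStep lam P (S.rss lam P) = S.rss lam P) {Ψ : (Fin k → ℝ) → ℝ}
    (hΨ : ∀ i δ, S.deviationGain lam P δ (S.sample i) ≤ Ψ (S.sample i)) (t : ℕ) (y : Fin n → ℝ) :
    ∫ w, value P (S.rss lam P) (S.next y ((S.policySS lam P).act t y) w) ∂(γ.dist t y) ≤
      value P (S.rss lam P) y - S.stageCost (S.policySS lam P) t y
        + (S.stageConst lam P (S.rss lam P) + (N : ℝ)⁻¹ * ∑ i, Ψ (S.sample i) + lam * θ ^ 2) := by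
  set r := S.rss lam P with hrdef
  set u := (S.policySS lam P).act t y with hu
  set p := S.costate lam P r y with hp
  -- The stage identity with e = 0: no cross term is left, and the opponent's gain is at most `Ψ` at
  -- the sample point.
  have hbound : ∀ w i, value P r (S.next y u w) ≤
      (value P r y - S.stageCost (S.policySS lam P) t y + S.stageConst lam P r)
        + (2 * (p ⬝ᵥ S.Ξ *ᵥ (S.sample i - S.wbar)) + Ψ (S.sample i))
        + lam * ((w - S.sample i) ⬝ᵥ (w - S.sample i)) := fun w i => by
    have h := S.stage_identity hΦ hP.1 hR hlam r y 0 (w - S.wbar - lam⁻¹ • (S.Ξᵀ *ᵥ p))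
      (S.sample i) (S.policySS_act t y) (w := w) (by abel)
    rw [← hP.2, hr] at h
    have h1 := hΨ i (w - S.wbar - lam⁻¹ • (S.Ξᵀ *ᵥ p))
    simp only [Matrix.mulVec_zero, dotProduct_zero, zero_dotProduct, mul_zero, add_zero] at h
    rw [stageCost]
    linarith
  have hdist := S.integrable_disturbance_sq hN hθ hγ t y
  have hvm : Measurable fun w => value P r (S.next y u w) :=
    (continuous_value P r).measurable.comp (S.measurable_next_right y u)
  have hvint : Integrable (fun w => value P r (S.next y u w)) (γ.dist t y) := by
    obtain ⟨C₁, hC₁, h₁⟩ := exists_abs_value_le P r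
    obtain ⟨C₂, hC₂, h₂⟩ := S.exists_norm_next_sq_le lam P
    refine ((integrable_const (C₁ * (1 + C₂ * (1 + ‖y‖ ^ 2)))).add
      (hdist.const_mul (C₁ * C₂))).mono' hvm.aestronglyMeasurable (Eventually.of_forall fun w => ?_)
    refine (h₁ _).trans ?_
    have := mul_le_mul_of_nonneg_left (h₂ t y w) hC₁
    simp only [Pi.add_apply]
    linarith
  -- An optimal coupling is not needed: couplings within ε of the radius suffice, and ε tends to 0
  -- at the end.
  have key : ∀ ε > 0, ∫ w, value P r (S.next y u w) ∂(γ.dist t y) ≤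
      (value P r y - S.stageCost (S.policySS lam P) t y + S.stageConst lam P r)
        + (N : ℝ)⁻¹ * ∑ i, Ψ (S.sample i) + lam * (θ + ε) ^ 2 := by
    intro ε hε
    obtain ⟨η, h1, h2, h3⟩ := exists_coupling_of_W2_le hθ hε (hγ t y)
    have hηprob : IsProbabilityMeasure η := by
      constructor
      have := congrArg (fun μ : Measure (Fin k → ℝ) => μ Set.univ) h1
      simpa [Measure.fst_univ] using this
    set Ψ' : (Fin k → ℝ) → ℝ := fun v => 2 * (p ⬝ᵥ S.Ξ *ᵥ (v - S.wbar)) + Ψ v with hΨ'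
    have hsq0 : ∀ z : (Fin k → ℝ) × (Fin k → ℝ), 0 ≤ (z.1 - z.2) ⬝ᵥ (z.1 - z.2) := fun z =>
      dotProduct_self_nonneg _
    have hsqm : Measurable fun z : (Fin k → ℝ) × (Fin k → ℝ) => (z.1 - z.2) ⬝ᵥ (z.1 - z.2) :=
      measurable_dotProduct_self.comp (measurable_fst.sub measurable_snd)
    have hsqint : Integrable (fun z => (z.1 - z.2) ⬝ᵥ (z.1 - z.2)) η := by
      refine ⟨hsqm.aestronglyMeasurable, ?_⟩
      rw [hasFiniteIntegral_iff_ofReal (Eventually.of_forall hsq0)]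
      exact h3.trans_lt ENNReal.ofReal_lt_top
    have hsqle : ∫ z, (z.1 - z.2) ⬝ᵥ (z.1 - z.2) ∂η ≤ (θ + ε) ^ 2 := by
      rw [integral_eq_lintegral_of_nonneg_ae (Eventually.of_forall hsq0)
        hsqm.aestronglyMeasurable]
      exact ENNReal.toReal_le_of_le_ofReal (by positivity) h3
    have hΨν : Integrable Ψ' η.snd := by rw [h2]; exact S.integrable_ν hN Ψ'
    have hΨint : Integrable (fun z : (Fin k → ℝ) × (Fin k → ℝ) => Ψ' z.2) η :=
      hΨν.comp_measurable measurable_snd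
    have hΨval : ∫ z, Ψ' z.2 ∂η = (N : ℝ)⁻¹ * ∑ i, Ψ (S.sample i) := by
      have h4 : ∫ v, Ψ' v ∂η.snd = ∫ z, Ψ' z.2 ∂η :=
        integral_map measurable_snd.aemeasurable hΨν.1
      rw [← h4, h2, integral_ν]
      simp only [hΨ', Finset.sum_add_distrib, ← Finset.mul_sum]
      rw [← dotProduct_sum, ← Matrix.mulVec_sum, S.sum_sample_sub_wbar hN, Matrix.mulVec_zero,
        dotProduct_zero, mul_zero, zero_add]
    have hvη : Integrable (fun z : (Fin k → ℝ) × (Fin k → ℝ) => value P r (S.next y u z.1)) η := by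
      rw [← h1] at hvint
      exact hvint.comp_measurable measurable_fst
    -- The second marginal lives on the sample, so the bound on `Ψ` at sample points is enough.
    have hae : ∀ᵐ z ∂η, ∃ i, z.2 = S.sample i := by
      have := S.ae_ν
      rw [← h2] at this
      exact ae_of_ae_map measurable_snd.aemeasurable this
    calc ∫ w, value P r (S.next y u w) ∂(γ.dist t y)
        = ∫ z, value P r (S.next y u z.1) ∂η := by
          rw [← h1]
          exact integral_map measurable_fst.aemeasurable hvm.aestronglyMeasurable
      _ ≤ ∫ z, ((value P r y - S.stageCost (S.policySS lam P) t y + S.stageConst lam P r)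
            + Ψ' z.2 + lam * ((z.1 - z.2) ⬝ᵥ (z.1 - z.2))) ∂η := by
          refine integral_mono_ae hvη (((integrable_const _).add hΨint).add
            (hsqint.const_mul lam)) ?_
          filter_upwards [hae] with z hz
          obtain ⟨i, hi⟩ := hz
          rw [hi]
          exact hbound z.1 i
      _ = (value P r y - S.stageCost (S.policySS lam P) t y + S.stageConst lam P r)
            + (N : ℝ)⁻¹ * ∑ i, Ψ (S.sample i) + lam * ∫ z, (z.1 - z.2) ⬝ᵥ (z.1 - z.2) ∂η := by
          have hsum : Integrable (fun z : (Fin k → ℝ) × (Fin k → ℝ) =>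
              (value P r y - S.stageCost (S.policySS lam P) t y + S.stageConst lam P r)
                + Ψ' z.2) η := (integrable_const _).add hΨint
          rw [integral_add hsum (hsqint.const_mul lam),
            integral_add (integrable_const _) hΨint, integral_const, probReal_univ, one_smul,
            hΨval, integral_const_mul]
      _ ≤ _ := by gcongr
  have hcont : Tendsto (fun ε : ℝ =>
      (value P r y - S.stageCost (S.policySS lam P) t y + S.stageConst lam P r)
        + (N : ℝ)⁻¹ * ∑ i, Ψ (S.sample i) + lam * (θ + ε) ^ 2) (nhdsWithin 0 (Set.Ioi 0))
      (nhds ((value P r y - S.stageCost (S.policySS lam P) t y + S.stageConst lam P r)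
        + (N : ℝ)⁻¹ * ∑ i, Ψ (S.sample i) + lam * (θ + 0) ^ 2)) := by
    refine Tendsto.mono_left (Continuous.tendsto ?_ 0) nhdsWithin_le_nhds
    fun_prop
  have hfin := ge_of_tendsto hcont (eventually_mem_nhdsWithin.mono fun ε hε => key ε hε)
  rw [add_zero] at hfin
  linarith

/-- Telescoping: each stage trades its cost for a decrease of the expected value function, up to
`κ`. -/
theorem sum_integral_stageCost_le {κ : ℝ} {r : Fin n → ℝ}
    (h : ∀ t y, ∫ w, value P r (S.next y ((S.policySS lam P).act t y) w) ∂(γ.dist t y) ≤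
      value P r y - S.stageCost (S.policySS lam P) t y + κ) (T : ℕ) :
    ∑ t ∈ Finset.range T, ∫ y, S.stageCost (S.policySS lam P) t y
        ∂(S.stateLaw (S.policySS lam P) γ x t)
      + ∫ y, value P r y ∂(S.stateLaw (S.policySS lam P) γ x T) ≤ value P r x + T * κ := by
  induction T with
  | zero => simp [stateLaw_zero]
  | succ T ih =>
    have hv := fun t => S.integrable_value (lam := lam) (P := P) hN hθ hγ x t r
    have hc := S.integrable_stageCost (lam := lam) (P := P) hN hθ hγ x T
    have hm := (continuous_value P r).measurable
    have hd : Integrable (fun y => value P r y - S.stageCost (S.policySS lam P) T y)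
        (S.stateLaw (S.policySS lam P) γ x T) := (hv T).sub hc
    have h1 := integral_mono (S.integrable_integral_stateLaw _ γ x T hm (hv (T + 1)))
      (hd.add (integrable_const κ)) (h T)
    simp only [Pi.add_apply] at h1
    rw [← S.integral_stateLaw_succ _ γ x T hm (hv (T + 1)), integral_add hd
      (integrable_const κ), integral_sub (hv T) hc, integral_const, probReal_univ, one_smul] at h1
    rw [Finset.sum_range_succ]
    push_cast
    linarith

end Ball

/-- A real sequence bounded by an affine function has average growth at most the slope. -/
theorem limsup_average_le {a : ℕ → ℝ} {C κ : ℝ} (h : ∀ T, a T ≤ C + T * κ) :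
    limsup (fun T : ℕ => (((T : ℝ)⁻¹ : ℝ) : EReal) * ((a T : ℝ) : EReal)) atTop ≤ (κ : EReal) := by
  have hlim : Tendsto (fun T : ℕ => (T : ℝ)⁻¹ * C + κ) atTop (nhds κ) := by
    simpa using (tendsto_inv_atTop_nhds_zero_nat.mul_const C).add_const κ
  rw [← ((continuous_coe_real_ereal.tendsto _).comp hlim).limsup_eq]
  refine limsup_le_limsup ?_
  filter_upwards [eventually_gt_atTop 0] with T hT
  rw [← EReal.coe_mul, Function.comp_apply, EReal.coe_le_coe_iff]
  have hT' : (0 : ℝ) < T := by exact_mod_cast hT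
  calc (T : ℝ)⁻¹ * a T ≤ (T : ℝ)⁻¹ * (C + T * κ) := by gcongr; exact h T
    _ = _ := by field_simp

end LQProblem

end MinimaxLQ

theorem mainTheorem9 {n m k N : ℕ} (hN : 0 < N) (S : MinimaxLQ.LQProblem n m k N)
    (hQ : S.Q.PosSemidef) (hQf : S.Qf.PosSemidef) (hR : S.R.PosDef)
    (lam θ : ℝ) (hlam : 0 < lam) (hθ : 0 ≤ θ)
    (hpen : S.PenaltyCondition lam) (hstab : S.StabilizabilityCondition lam)
    (hobs : S.ObservabilityCondition) :
    ∃ P : Matrix (Fin n) (Fin n) ℝ,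
      -- `P` is the unique symmetric positive semidefinite solution of the Riccati equation
      (S.IsAREsolution lam P ∧ ∀ P', S.IsAREsolution lam P' → P' = P) ∧
      -- the inverses in the definition of the stationary policy exist
      IsUnit (1 + P * S.Φ lam) ∧ IsUnit (1 - S.Aᵀ * (1 + P * S.Φ lam)⁻¹) ∧
      -- all expectations below are those of integrable random variables
      (∀ x, ∀ γ ∈ S.ballPolicies θ, ∀ T : ℕ,
        Integrable (S.runCost (S.policySS lam P) T) (S.law (S.policySS lam P) γ x) ∧
        Integrable (fun ω => S.bias lam P (ω T)) (S.law (S.policySS lam P) γ x)) ∧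
      -- the bound on the extended average cost; `x'` is the initial state in the definition of `ρ`
      (∀ x x', ⨆ γ ∈ S.ballPolicies θ,
          S.extAvgCost (S.bias lam P) (S.policySS lam P) γ x
        ≤ ((lam * θ ^ 2 : ℝ) : EReal) + S.steadyCost lam x') ∧
      -- the bound on the average cost
      (∀ x x', ∀ G ⊆ S.ballPolicies θ,
        (∀ γ ∈ G, S.avgBias (S.bias lam P) (S.policySS lam P) γ x = 0) →
        ⨆ γ ∈ G, S.avgCost (S.policySS lam P) γ x
          ≤ ((lam * θ ^ 2 : ℝ) : EReal) + S.steadyCost lam x') := by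
  obtain ⟨P, hP, hlim⟩ := S.exists_tendsto_riccatiZero hQ hstab
  have hΦ := hstab.1
  have hunit : IsUnit (1 - S.Aᵀ * (1 + P * S.Φ lam)⁻¹) := by
    rw [← S.transpose_closedLoop hΦ hP.1, ← Matrix.transpose_one, ← Matrix.transpose_sub]
    exact (Matrix.isUnit_transpose _).2 (hP.isUnit_one_sub hQ hΦ hobs)
  have hr := S.rss_eq_linearStep hunit
  have hcost := fun γ (hγ : γ ∈ S.ballPolicies θ) x T =>
    S.integrable_runCost (S.policySS lam P) γ x (T := T)
      fun t _ => S.integrable_stageCost hN hθ hγ x t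
  have hvalue := fun γ (hγ : γ ∈ S.ballPolicies θ) x T => S.integrable_law (S.policySS lam P) γ x T
    (S.integrable_value (P := P) hN hθ hγ x T (S.rss lam P))
  -- One slope `κ` bounds the growth for all opponents in the ball and all initial states. It is
  -- built from suprema of gains, finite only because the steady cost is.
  have hslope : ∀ x', S.steadyCost lam x' ≠ ⊤ → ∃ κ : ℝ,
      (κ : EReal) ≤ ((lam * θ ^ 2 : ℝ) : EReal) + S.steadyCost lam x' ∧
      ∀ γ ∈ S.ballPolicies θ, ∀ x T, ∫ ω, S.runCost (S.policySS lam P) T ω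
          ∂(S.law (S.policySS lam P) γ x)
        + ∫ ω, S.bias lam P (ω T) ∂(S.law (S.policySS lam P) γ x) ≤ S.bias lam P x + T * κ := by
    intro x' htop
    have hlow := S.le_steadyCost hN hQ hQf hR hlam hΦ hobs hP hlim
      (S.quad_limit_le hQ hQf hΦ hpen hlim) x'
    have hbot : S.steadyCost lam x' ≠ ⊥ := fun h => by
      have := hlow 0
      rw [h, le_bot_iff] at this
      exact EReal.coe_ne_bot _ this
    set ρ := (S.steadyCost lam x').toReal with hρ
    have hρeq : S.steadyCost lam x' = (ρ : EReal) := (EReal.coe_toReal htop hbot).symm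
    simp only [hρeq, EReal.coe_le_coe_iff] at hlow
    have hN' : (0 : ℝ) < N := by exact_mod_cast hN
    -- The lower bound on the steady cost holds for all deviations jointly; this bounds each gain
    -- and lets the supremum pass inside the sum.
    obtain ⟨hbdd, hsup⟩ := MinimaxLQ.sum_ciSup_le
      (f := fun i δ => S.deviationGain lam P δ (S.sample i))
      (C := N * (ρ - S.stageConst lam P (S.rss lam P))) fun δ => by
        have h1 := hlow δ
        rw [← le_sub_iff_add_le', inv_mul_le_iff₀ hN'] at h1
        exact h1
    rw [← inv_mul_le_iff₀ hN'] at hsup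
    refine ⟨S.stageConst lam P (S.rss lam P)
      + (N : ℝ)⁻¹ * ∑ i, (⨆ δ, S.deviationGain lam P δ (S.sample i)) + lam * θ ^ 2, ?_,
      fun γ hγ x T => ?_⟩
    · rw [hρeq, ← EReal.coe_add, EReal.coe_le_coe_iff]
      linarith
    · have h1 := S.sum_integral_stageCost_le hN hθ hγ x
        (S.integral_value_next_le hN hθ hγ hΦ hP hR hlam hr
          (Ψ := fun v => ⨆ δ, S.deviationGain lam P δ v) fun i δ => le_ciSup (hbdd i) δ) T
      rw [S.integral_runCost (S.policySS lam P) γ x fun t _ => S.integrable_stageCost hN hθ hγ x t]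
      have h2 := S.integral_law (S.policySS lam P) γ x T
        (MinimaxLQ.LQProblem.continuous_value P (S.rss lam P)).measurable
      exact (congrArg _ h2).trans_le h1
  refine ⟨P, ⟨hP, fun P' hP' => hP.eq_of_tendsto hQ hΦ hobs hlim hP'⟩,
    MinimaxLQ.isUnit_one_add_mul hP.1 hΦ, hunit,
    fun x γ hγ T => ⟨hcost γ hγ x T, hvalue γ hγ x T⟩, fun x x' => ?_, fun x x' G hG _ => ?_⟩
  · by_cases htop : S.steadyCost lam x' = ⊤
    · rw [htop, EReal.coe_add_top]
      exact le_top
    obtain ⟨κ, hκ, h⟩ := hslope x' htop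
    refine iSup₂_le fun γ hγ => le_trans ?_ hκ
    rw [MinimaxLQ.LQProblem.extAvgCost]
    have heq : ∀ T : ℕ, MinimaxLQ.eexp (S.law (S.policySS lam P) γ x)
        (fun ω => ((S.runCost (S.policySS lam P) T ω + S.bias lam P (ω T) : ℝ) : EReal)) =
        ((∫ ω, S.runCost (S.policySS lam P) T ω ∂(S.law (S.policySS lam P) γ x)
          + ∫ ω, S.bias lam P (ω T) ∂(S.law (S.policySS lam P) γ x) : ℝ) : EReal) := fun T =>
      (MinimaxLQ.eexp_coe (f := fun ω => S.runCost (S.policySS lam P) T ω + S.bias lam P (ω T))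
        ((hcost γ hγ x T).add (hvalue γ hγ x T))).trans
        (congrArg _ (integral_add (hcost γ hγ x T) (hvalue γ hγ x T)))
    simp only [heq]
    exact MinimaxLQ.LQProblem.limsup_average_le (h γ hγ x)
  · by_cases htop : S.steadyCost lam x' = ⊤
    · rw [htop, EReal.coe_add_top]
      exact le_top
    obtain ⟨κ, hκ, h⟩ := hslope x' htop
    -- `P` has trivial kernel, so the bias is bounded below by some `C`; removing its expectation
    -- shifts the intercept of the affine bound and leaves the slope.
    obtain ⟨C, hC⟩ := MinimaxLQ.LQProblem.exists_le_value hP.1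
      (fun z => hP.eq_zero_of_mulVec_eq_zero hQ hΦ hobs) (S.rss lam P)
    refine iSup₂_le fun γ hγ => le_trans ?_ hκ
    rw [MinimaxLQ.LQProblem.avgCost]
    simp only [fun T => MinimaxLQ.eexp_coe (hcost γ (hG hγ) x T)]
    refine MinimaxLQ.LQProblem.limsup_average_le (C := S.bias lam P x - C) fun T => ?_
    have h1 := h γ (hG hγ) x T
    have h2 : C ≤ ∫ ω, S.bias lam P (ω T) ∂(S.law (S.policySS lam P) γ x) := by
      have h3 := integral_mono (μ := S.law (S.policySS lam P) γ x) (integrable_const C)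
        (hvalue γ (hG hγ) x T) fun ω => hC (ω T)
      rwa [integral_const, probReal_univ, one_smul] at h3
    linarith
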